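/- Let $E$ be a countable set and let $R:E\times E\to\mathbb R$ satisfy $R(\eta,\xi)\ge 0$ for $\eta\ne\xi$, $-\infty<R(\eta,\eta)<0$ and $\sum_{\xi\in E}R(\eta,\xi)=0$ for all $\eta\in E$. Put $\lambda(\eta)=-R(\eta,\eta)$, $p(\eta,\xi)=R(\eta,\xi)/\lambda(\eta)$ for $\eta\neq\xi$ and $p(\eta,\eta)=0$. Assume that the discrete time Markov chain with transition probabilities $p$ is irreducible and recurrent. Let $\mathbf P_\eta$ (with expectation $\mathbf E_\eta$) be the probability measure under which $Y=(Y_n)_{n\ge 0}$ is this chain started from $\eta$ and $(e_n)_{n\ge0}$ are i.i.d. mean one exponential random variables independent of $Y$, and let $\eta_t=Y_{\alpha(t)}$, where $\alpha(t)=\min\{n\ge 0:\sum_{i=0}^n e_i/\lambda(Y_i)>t\}$, be the associated continuous time Markov chain. Assume that $(\eta_t)_{t\ge0}$ is positive recurrent and let $\mu$ be its invariant probability measure. For $\xi\in E$ let $T_\xi=\inf\{t>0:\eta_t=\xi\}$. Suprema and expectations of nonnegative quantities take values in $[0,\infty]$. **Lemma.** Let $g:E\to\mathbb R$ be $\mu$-integrable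 with nonempty support $A=\{\eta:g(\eta)\ne0\}$ and $\int g\,d\mu=0$, and fix $\xi\in A$. Then, for every $t>0$, the expectations on the left-hand side below converge absolutely and $$\sup_{\eta\in E}\Big|\mathbf E_\eta\Big[\int_0^t g(\eta_s)\,ds\Big]\Big|\;\le\;2\,\sup_{\eta\in A}\mathbf E_\eta\Big[\int_0^{T_\xi}|g(\eta_s)|\,ds\Big].$$ **Corollary.** Let $S$ be a finite set, let $\pi=\{A^x:x\in S\}$ be a partition of $E$, and fix a state $\xi_x\in A^x$ for each $x\in S$. Let $\mu^x=\mu(\,\cdot\,|A^x)$. For a $\mu$-integrable $g:E\to\mathbb R$ let $\langle g|\pi\rangle_\mu=\sum_{x\in S}\big(\int g\,d\mu^x\big)\mathbf 1\{A^x\}$ be its conditional expectation given $\pi$ and let $g^x=\big(g-\int g\,d\mu^x\big)\mathbf 1\{A^x\}$. Then, for every $t>0$, the expectations on the left-hand side below converge absolutely and $$\sup_{\eta\in E}\Big|\mathbf E_\eta\Big[\int_0^t\big\{g-\langle g|\pi\rangle_\mu\big\}(\eta_s)\,ds\Big]\Big|\;\le\;2\sum_{x\in S}\ \sup_{\eta\in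 A^x}\mathbf E_\eta\Big[\int_0^{T_{\xi_x}}|g^x(\eta_s)|\,ds\Big].$$ -/

import Mathlib

open MeasureTheory ProbabilityTheory
open scoped ENNReal

noncomputable section

/-- Transition rates on `E`: finite nonnegative off-diagonal entries, strictly negative
diagonal entries, and rows summing to zero. -/
structure TransitionRates (E : Type*) where
  rate : E → E → ℝ
  rate_nonneg : ∀ η ξ, η ≠ ξ → 0 ≤ rate η ξ
  rate_self_neg : ∀ η, rate η η < 0
  hasSum_rate : ∀ η, HasSum (rate η) 0

/-- The hitting time `inf {s > 0 : e s ∈ A}` of a path `e`, equal to `∞` if the set is empty.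
Paths are indexed by `ℝ`, but only their values at nonnegative times are ever used. -/
def pathHittingTime {E : Type*} (e : ℝ → E) (A : Set E) : ℝ≥0∞ :=
  ⨅ (t : ℝ) (_ : 0 < t ∧ e t ∈ A), ENNReal.ofReal t

/-- The first return time `inf {t > 0 : e t ∈ A, e s ≠ e 0 for some 0 < s < t}`. -/
def pathReturnTime {E : Type*} (e : ℝ → E) (A : Set E) : ℝ≥0∞ :=
  ⨅ (t : ℝ) (_ : 0 < t ∧ e t ∈ A ∧ ∃ s, 0 < s ∧ s < t ∧ e s ≠ e 0), ENNReal.ofReal t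

namespace TransitionRates

variable {E : Type*} (Q : TransitionRates E)

/-- The holding rate `λ(η) = -R(η, η)`. -/
def holdingRate (η : E) : ℝ := -Q.rate η η

open Classical in
/-- The jump probabilities: `p(η, ξ) = R(η, ξ) / λ(η)` for `η ≠ ξ`, and `p(η, η) = 0`. -/
def jumpProb (η ξ : E) : ℝ := if η = ξ then 0 else Q.rate η ξ / Q.holdingRate η

theorem holdingRate_pos (η : E) : 0 < Q.holdingRate η := neg_pos.2 (Q.rate_self_neg η)

theorem jumpProb_nonneg (η ξ : E) : 0 ≤ Q.jumpProb η ξ := by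
  unfold jumpProb
  split_ifs with h
  · exact le_rfl
  · exact div_nonneg (Q.rate_nonneg η ξ h) (Q.holdingRate_pos η).le

theorem hasSum_jumpProb (η : E) : HasSum (Q.jumpProb η) 1 := by
  classical
  have h := ((Q.hasSum_rate η).update η 0).div_const (Q.holdingRate η)
  have h1 : (0 - Q.rate η η + 0) / Q.holdingRate η = 1 := by
    rw [zero_sub, add_zero]
    exact div_self (Q.holdingRate_pos η).ne'
  rw [h1] at h
  refine h.congr_fun ?_
  intro ξ
  unfold jumpProb
  by_cases hx : η = ξ
  · subst hx; simp
  · simp [hx, Function.update_of_ne (Ne.symm hx)]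

/-- The law of the position after one jump from `η`. -/
def jumpMeasure [MeasurableSpace E] (η : E) : Measure E :=
  Measure.sum fun ξ => ENNReal.ofReal (Q.jumpProb η ξ) • Measure.dirac ξ

instance [MeasurableSpace E] (η : E) : IsProbabilityMeasure (Q.jumpMeasure η) := by
  constructor
  rw [jumpMeasure, Measure.sum_apply _ MeasurableSet.univ]
  simp only [Measure.smul_apply, measure_univ, smul_eq_mul, mul_one]
  rw [← ENNReal.ofReal_tsum_of_nonneg (Q.jumpProb_nonneg η) (Q.hasSum_jumpProb η).summable,
    (Q.hasSum_jumpProb η).tsum_eq, ENNReal.ofReal_one]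

section Construction

variable [Countable E] [MeasurableSpace E] [DiscreteMeasurableSpace E]

/-- One step of the jump chain, given its past up to time `n`. -/
def jumpStep (n : ℕ) : Kernel ((i : Finset.Iic n) → (fun _ : ℕ => E) i) E where
  toFun y := Q.jumpMeasure (y ⟨n, Finset.mem_Iic.2 le_rfl⟩)
  measurable' := (Measurable.of_discrete (f := Q.jumpMeasure)).comp (measurable_pi_apply _)

instance (n : ℕ) : IsMarkovKernel (Q.jumpStep n) :=
  ⟨fun _ => inferInstanceAs (IsProbabilityMeasure (Q.jumpMeasure _))⟩

/-- The law of the jump chain `(Y_n)` started from `η`. -/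
def jumpChainLaw (η : E) : Measure (ℕ → E) :=
  Kernel.traj (X := fun _ => E) Q.jumpStep 0 (fun _ => η)

/-- The probability measure `P_η` on the sample space of pairs `(Y, e)`: under it, `Y` is the jump
chain started from `η`, and `e` is an independent sequence of i.i.d. mean one exponential
variables. -/
def pathMeasure (η : E) : Measure ((ℕ → E) × (ℕ → ℝ)) :=
  (Q.jumpChainLaw η).prod (Measure.infinitePi fun _ : ℕ => expMeasure 1)

end Construction

/-- `α(t) = min {n : ∑_{i ≤ n} e_i / λ(Y_i) > t}`. (It is `0` if there is no such `n`, which has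
probability zero when the jump chain is recurrent.) -/
def jumpIndex (t : ℝ) (ω : (ℕ → E) × (ℕ → ℝ)) : ℕ :=
  sInf {n : ℕ | t < ∑ i ∈ Finset.range (n + 1), ω.2 i / Q.holdingRate (ω.1 i)}

/-- The continuous time Markov chain `η_t = Y_{α(t)}`. -/
def process (t : ℝ) (ω : (ℕ → E) × (ℕ → ℝ)) : E := ω.1 (Q.jumpIndex t ω)

/-- The hitting time `T_ξ` of the state `ξ`. -/
def hittingTime (ξ : E) (ω : (ℕ → E) × (ℕ → ℝ)) : ℝ≥0∞ :=
  pathHittingTime (fun s => Q.process s ω) {ξ}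

/-- The first return time `T⁺_ξ` to the state `ξ`. -/
def returnTime (ξ : E) (ω : (ℕ → E) × (ℕ → ℝ)) : ℝ≥0∞ :=
  pathReturnTime (fun s => Q.process s ω) {ξ}

section Expectations

variable [Countable E] [MeasurableSpace E] [DiscreteMeasurableSpace E]

/-- The jump chain is irreducible. -/
def IsIrreducible : Prop := ∀ η ξ : E, ∃ n : ℕ, 0 < Q.jumpChainLaw η {y | y n = ξ}

/-- The jump chain is recurrent. -/
def IsRecurrent : Prop := ∀ η : E, ∀ᵐ y ∂Q.jumpChainLaw η, ∃ n : ℕ, 1 ≤ n ∧ y n = η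

/-- All mean return times of the continuous time chain are finite. Together with irreducibility and
recurrence of the jump chain (which excludes explosion) this is positive recurrence. -/
def HasFiniteMeanReturnTimes : Prop :=
  ∀ η : E, ∫⁻ ω, Q.returnTime η ω ∂Q.pathMeasure η < ∞

/-- `μ` is invariant for the continuous time chain:
`∑_η μ(η) P_η[η_t = ξ] = μ(ξ)` for all `t ≥ 0` and all `ξ`. -/
def IsInvariant (μ : Measure E) : Prop :=
  ∀ t : ℝ, 0 ≤ t → ∀ ξ : E,
    ∑' η : E, μ {η} * Q.pathMeasure η {ω | Q.process t ω = ξ} = μ {ξ}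

/-- The function `(ω, s) ↦ g(η_s(ω))` is integrable over `P_η ⊗ ds` on `0 ≤ s ≤ t`, that is,
`E_η[∫_0^t g(η_s) ds]` is absolutely convergent. -/
def TimeIntegrable (g : E → ℝ) (t : ℝ) (η : E) : Prop :=
  Integrable (fun p : ((ℕ → E) × (ℕ → ℝ)) × ℝ => g (Q.process p.2 p.1))
    ((Q.pathMeasure η).prod (volume.restrict (Set.Icc 0 t)))

/-- `E_η[∫_0^t g(η_s) ds]`. -/
def expTimeIntegral (g : E → ℝ) (t : ℝ) (η : E) : ℝ :=
  ∫ ω, (∫ s in (0 : ℝ)..t, g (Q.process s ω)) ∂Q.pathMeasure η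

/-- `E_η[∫_0^{T_ξ} |g(η_s)| ds]`, with values in `[0, ∞]`. -/
def expAbsIntegralUntilHit (g : E → ℝ) (ξ η : E) : ℝ≥0∞ :=
  ∫⁻ ω, (∫⁻ s in {s : ℝ | 0 ≤ s ∧ ENNReal.ofReal s < Q.hittingTime ξ ω},
    ENNReal.ofReal |g (Q.process s ω)|) ∂Q.pathMeasure η

end Expectations

end TransitionRates

/-- The conditional expectation `⟨g | π⟩_μ = ∑_x ⟨g⟩_{μ(· | A x)} 1{A x}` of `g` given the finite
partition `π = {A x}`. -/
def partitionCondExp {E S : Type*} [MeasurableSpace E] [Fintype S] (μ : Measure E)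
    (A : S → Set E) (g : E → ℝ) (η : E) : ℝ :=
  ∑ x, (A x).indicator (fun _ => ∫ ζ, g ζ ∂(cond μ (A x))) η

/-- `g^x = (g - ⟨g⟩_{μ(· | B)}) 1{B}` for the block `B = A x`. -/
def centeredOn {E : Type*} [MeasurableSpace E] (μ : Measure E) (B : Set E) (g : E → ℝ) : E → ℝ :=
  B.indicator fun η => g η - ∫ ζ, g ζ ∂(cond μ B)

end

/-!
The measures `U_t(η, ·) = E_η[∫_0^t 1{η_s ∈ ·} ds]` satisfy `μ U_t = t μ` by invariance. If a
bounded `f` solves the Poisson equation `f - p f = g / λ`, then `U_t g` is, by the compensator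
formula, an expected sum of increments `f(Y_n) - f(Y_{n+1})` over the jumps up to time `t`. This sum
telescopes, whence `|U_t g| ≤ 2 sup |f|` for all `t`.

The potential of `g / λ` for the jump chain killed at `ξ` solves the equation off `ξ`; by the
maximum principle it is bounded by its supremum over the support of `g`, which the hitting time
integrals control. Replacing `g ξ` by some `g ξ + d` makes the equation hold at `ξ` as well.
Integrating the bound against `μ` then gives `t |∫ g dμ + d μ(ξ)| ≤ 2 sup |f|` for all `t`, so that
`d = 0`.
-/

noncomputable section

section Exponential

theorem expMeasure_Ioi {a : ℝ} (ha : 0 < a) {u : ℝ} (hu : 0 ≤ u) :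
    expMeasure a (Set.Ioi u) = ENNReal.ofReal (Real.exp (-(a * u))) := by
  have := isProbabilityMeasure_expMeasure ha
  rw [← Set.compl_Iic, prob_compl_eq_one_sub measurableSet_Iic, ← ofReal_cdf,
    cdf_expMeasure_eq ha, if_pos hu, ← ENNReal.ofReal_one,
    ← ENNReal.ofReal_sub _ (by simpa using mul_nonneg ha.le hu), sub_sub_cancel]

theorem ae_expMeasure_pos {a : ℝ} (ha : 0 < a) : ∀ᵐ x ∂expMeasure a, 0 < x := by
  have := isProbabilityMeasure_expMeasure ha
  have h : expMeasure a (Set.Ioi 0) = 1 := by simp [expMeasure_Ioi ha le_rfl]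
  exact (prob_compl_eq_zero_iff measurableSet_Ioi).2 h

theorem lintegral_exp_neg_expMeasure {a : ℝ} (ha : 0 < a) :
    ∫⁻ x, ENNReal.ofReal (Real.exp (-x)) ∂expMeasure a = ENNReal.ofReal (a / (1 + a)) := by
  have hpdf (x : ℝ) : exponentialPDF a x * ENNReal.ofReal (Real.exp (-x)) =
      ENNReal.ofReal (a / (1 + a)) * exponentialPDF (1 + a) x := by
    rcases lt_or_ge x 0 with hx | hx
    · simp only [exponentialPDF_of_neg hx, zero_mul, mul_zero]
    · rw [exponentialPDF_of_nonneg hx, exponentialPDF_of_nonneg hx,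
        ← ENNReal.ofReal_mul (by positivity), ← ENNReal.ofReal_mul (by positivity), mul_assoc,
        ← Real.exp_add, ← mul_assoc, div_mul_cancel₀ _ (by positivity)]
      ring_nf
  calc ∫⁻ x, ENNReal.ofReal (Real.exp (-x)) ∂expMeasure a
      = ∫⁻ x, exponentialPDF a x * ENNReal.ofReal (Real.exp (-x)) :=
        lintegral_withDensity_eq_lintegral_mul _
          (measurable_exponentialPDFReal a).ennreal_ofReal (by fun_prop)
    _ = ENNReal.ofReal (a / (1 + a)) := by
        simp_rw [hpdf]
        rw [lintegral_const_mul' _ _ ENNReal.ofReal_ne_top,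
          lintegral_exponentialPDF_eq_one (by positivity), mul_one]

theorem expMeasure_map_div {a : ℝ} (ha : 0 < a) :
    (expMeasure 1).map (· / a) = expMeasure a := by
  have := isProbabilityMeasure_expMeasure ha
  have := isProbabilityMeasure_expMeasure one_pos
  have := Measure.isProbabilityMeasure_map (μ := expMeasure 1) (f := (· / a)) (by fun_prop)
  refine Measure.eq_of_cdf _ _ (StieltjesFunction.ext fun x => ?_)
  have hpre : (· / a) ⁻¹' Set.Iic x = Set.Iic (a * x) := by
    ext y
    simp [div_le_iff₀' ha]
  rw [cdf_eq_real, map_measureReal_apply (by fun_prop) measurableSet_Iic, hpre, ← cdf_eq_real,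
    cdf_expMeasure_eq one_pos, cdf_expMeasure_eq ha]
  simp only [one_mul, mul_nonneg_iff_of_pos_left ha]

/-- The tail of an exponential variable is `1 / a` times its density. -/
theorem lintegral_volume_Ico_inter_expMeasure {a : ℝ} (ha : 0 < a) {B : Set ℝ}
    (hB : MeasurableSet B) :
    ∫⁻ x, volume (Set.Ico 0 x ∩ B) ∂expMeasure a = ENNReal.ofReal (1 / a) * expMeasure a B := by
  have := isProbabilityMeasure_expMeasure ha
  have htail (u : ℝ) : ∫⁻ x, (Set.Ico 0 x).indicator 1 u ∂expMeasure a =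
      ENNReal.ofReal (1 / a) * exponentialPDF a u := by
    rcases lt_or_ge u 0 with hu | hu
    · simp [exponentialPDF_of_neg hu, hu.not_ge]
    · have hind : (fun x : ℝ => (Set.Ico 0 x).indicator (1 : ℝ → ℝ≥0∞) u) =
          (Set.Ioi u).indicator 1 := by
        ext x
        simp [Set.indicator_apply, hu]
      rw [hind, lintegral_indicator_one measurableSet_Ioi, expMeasure_Ioi ha hu,
        exponentialPDF_of_nonneg hu, ← ENNReal.ofReal_mul (by positivity), ← mul_assoc,
        one_div_mul_cancel ha.ne', one_mul]
  have hmeas : Measurable (Function.uncurry fun x u : ℝ =>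
      (Set.Ico 0 x).indicator (1 : ℝ → ℝ≥0∞) u) :=
    measurable_one.indicator (s := {p : ℝ × ℝ | p.2 ∈ Set.Ico 0 p.1})
      ((measurableSet_le measurable_const measurable_snd).inter
        (measurableSet_lt measurable_snd measurable_fst))
  calc ∫⁻ x, volume (Set.Ico 0 x ∩ B) ∂expMeasure a
      = ∫⁻ x, (∫⁻ u in B, (Set.Ico 0 x).indicator 1 u) ∂expMeasure a := by
        simp_rw [lintegral_indicator_one measurableSet_Ico,
          Measure.restrict_apply measurableSet_Ico]
    _ = ∫⁻ u in B, ENNReal.ofReal (1 / a) * exponentialPDF a u := by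
        rw [lintegral_lintegral_swap hmeas.aemeasurable]
        simp_rw [htail]
    _ = ENNReal.ofReal (1 / a) * expMeasure a B := by
        rw [lintegral_const_mul' _ _ ENNReal.ofReal_ne_top]
        congr 1
        exact (withDensity_apply _ hB).symm

theorem measurable_volume_Ico_inter {Ω : Type*} [MeasurableSpace Ω] {f g : Ω → ℝ}
    (hf : Measurable f) (hg : Measurable g) {B : Set ℝ} (hB : MeasurableSet B) :
    Measurable fun ω => volume (Set.Ico (f ω) (g ω) ∩ B) :=
  measurable_measure_prodMk_left (s := {p : Ω × ℝ | (f p.1 ≤ p.2 ∧ p.2 < g p.1) ∧ p.2 ∈ B})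
    (by measurability)

/-- The compensator formula for a single ring, at time `S + X`, of an exponential clock. -/
theorem lintegral_volume_Ico_add_inter {Ω : Type*} [MeasurableSpace Ω] {P : Measure Ω}
    [IsProbabilityMeasure P] {S X : Ω → ℝ} {a : ℝ} (ha : 0 < a) (hS : Measurable S)
    (hX : HasLaw X (expMeasure a) P) (hSX : IndepFun S X P) {B : Set ℝ} (hB : MeasurableSet B) :
    ∫⁻ ω, volume (Set.Ico (S ω) (S ω + X ω) ∩ B) ∂P =
      ENNReal.ofReal (1 / a) * P {ω | S ω + X ω ∈ B} := by
  have := isProbabilityMeasure_expMeasure ha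
  have hshift (c x : ℝ) : volume (Set.Ico c (c + x) ∩ B) =
      volume (Set.Ico 0 x ∩ (c + ·) ⁻¹' B) := by
    rw [← measure_preimage_add volume c (Set.Ico c (c + x) ∩ B), Set.preimage_inter,
      Set.preimage_const_add_Ico, sub_self, add_sub_cancel_left]
  have hvol : Measurable fun p : ℝ × ℝ => volume (Set.Ico p.1 (p.1 + p.2) ∩ B) :=
    measurable_volume_Ico_inter measurable_fst measurable_add hB
  have hadd : MeasurableSet {p : ℝ × ℝ | p.1 + p.2 ∈ B} := measurable_add hB
  have hlaw : HasLaw (fun ω => (S ω, X ω)) ((P.map S).prod (expMeasure a)) P :=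
    hSX.hasLaw_prod ⟨hS.aemeasurable, rfl⟩ hX
  calc ∫⁻ ω, volume (Set.Ico (S ω) (S ω + X ω) ∩ B) ∂P
      = ∫⁻ p, volume (Set.Ico p.1 (p.1 + p.2) ∩ B) ∂(P.map S).prod (expMeasure a) :=
        hlaw.lintegral_comp hvol.aemeasurable
    _ = ∫⁻ c, ENNReal.ofReal (1 / a) * expMeasure a ((c + ·) ⁻¹' B) ∂P.map S := by
        rw [lintegral_prod _ hvol.aemeasurable]
        refine lintegral_congr fun c => ?_
        simp only [hshift, lintegral_volume_Ico_inter_expMeasure ha (measurable_const_add c hB)]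
    _ = ENNReal.ofReal (1 / a) * P {ω | S ω + X ω ∈ B} := by
        rw [lintegral_const_mul' _ _ ENNReal.ofReal_ne_top, hlaw.measure_eq hadd,
          Measure.prod_apply hadd]
        rfl

instance : IsProbabilityMeasure (expMeasure 1) := isProbabilityMeasure_expMeasure one_pos

end Exponential

theorem measurable_sInf_nat {Ω : Type*} [MeasurableSpace Ω] {A : ℕ → Set Ω}
    (hA : ∀ n, MeasurableSet (A n)) : Measurable fun ω => sInf {n | ω ∈ A n} := by
  refine measurable_of_Iic fun n => ?_
  have hpre : (fun ω => sInf {m | ω ∈ A m}) ⁻¹' Set.Iic n =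
      (⋂ m, (A m)ᶜ) ∪ ⋃ m ∈ Set.Iic n, A m := by
    ext ω
    simp only [Set.mem_preimage, Set.mem_Iic, Set.mem_union, Set.mem_iInter, Set.mem_compl_iff,
      Set.mem_iUnion, exists_prop]
    constructor
    · intro h
      by_cases hne : ∃ m, ω ∈ A m
      · exact Or.inr ⟨_, h, Nat.sInf_mem hne⟩
      · exact Or.inl (not_exists.1 hne)
    · rintro (h | ⟨m, hmn, hm⟩)
      · simp [h]
      · exact (Nat.sInf_le hm).trans hmn
  rw [hpre]
  exact (MeasurableSet.iInter fun m => (hA m).compl).union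
    (MeasurableSet.biUnion (Set.to_countable _) fun m _ => hA m)

theorem exists_sum_range_indicator_sub_eq (F : ℕ → ℝ) {s : Set ℕ} (hs : IsLowerSet s) (N : ℕ) :
    ∃ k, ∑ n ∈ Finset.range N, s.indicator (fun n => F n - F (n + 1)) n = F 0 - F k := by
  induction N generalizing F s with
  | zero => exact ⟨0, by simp⟩
  | succ N ih =>
    by_cases h0 : 0 ∈ s
    · obtain ⟨k, hk⟩ := ih (fun n => F (n + 1)) (s := (· + 1) ⁻¹' s)
        fun a b hba ha => hs (Nat.succ_le_succ hba) ha
      refine ⟨k + 1, ?_⟩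
      rw [Finset.sum_range_succ', Set.indicator_of_mem h0]
      have hshift (n : ℕ) : s.indicator (fun n => F n - F (n + 1)) (n + 1) =
          ((· + 1) ⁻¹' s).indicator (fun n => F (n + 1) - F (n + 1 + 1)) n := rfl
      simp only [hshift, hk]
      ring
    · have hempty : s = ∅ := Set.eq_empty_of_forall_notMem fun n hn => h0 (hs (Nat.zero_le n) hn)
      exact ⟨0, by simp [hempty]⟩

section Potential

variable {E : Type*} [MeasurableSpace E]

/-- The operator `h ↦ c · P h`: a step of the chain with kernel `P`, weighted by `c` at the state
from which the step is made. -/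
def weightedStep (P : Kernel E E) (c h : E → ℝ≥0∞) (x : E) : ℝ≥0∞ := c x * ∫⁻ y, h y ∂P x

/-- The potential `∑ₙ (c P)ⁿ (c ψ)` of the charge `ψ` for the chain with kernel `P` which at every
state `x`, the starting point included, survives with probability `c x`. -/
def killedPotential (P : Kernel E E) (c ψ : E → ℝ≥0∞) (x : E) : ℝ≥0∞ :=
  ∑' n, (weightedStep P c)^[n] (c * ψ) x

variable {P : Kernel E E} {c : E → ℝ≥0∞}

theorem monotone_weightedStep : Monotone (weightedStep P c) := fun _ _ h x =>
  mul_le_mul_right (lintegral_mono h) (c x)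

/-- Optional stopping for the submartingale `u` of the chain at its first visit to `η`; the iterate
is the probability that this visit has not occurred within `n` steps. -/
theorem le_add_iterate_weightedStep [IsMarkovKernel P] {u : E → ℝ≥0∞} (hu : ∀ x, u x ≤ 1) {η : E}
    (hsub : ∀ x, u x ≤ ∫⁻ y, u y ∂P x) (n : ℕ) (x : E) :
    u x ≤ u η + (weightedStep P (({η} : Set E)ᶜ.indicator 1))^[n] 1 x := by
  induction n generalizing x with
  | zero => exact (hu x).trans le_add_self
  | succ n ih =>
    by_cases hx : x = η
    · exact hx ▸ le_self_add
    · calc u x ≤ ∫⁻ y, u y ∂P x := hsub x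
        _ ≤ ∫⁻ y, (u η + (weightedStep P (({η} : Set E)ᶜ.indicator 1))^[n] 1 y) ∂P x :=
          lintegral_mono ih
        _ = u η + (weightedStep P (({η} : Set E)ᶜ.indicator 1))^[n + 1] 1 x := by
          rw [lintegral_add_left measurable_const, Function.iterate_succ_apply']
          simp [weightedStep, hx]

variable [DiscreteMeasurableSpace E]

theorem weightedStep_sum (s : Finset ℕ) (h : ℕ → E → ℝ≥0∞) :
    weightedStep P c (fun x => ∑ n ∈ s, h n x) = fun x => ∑ n ∈ s, weightedStep P c (h n) x := by
  ext x
  simp only [weightedStep, lintegral_finsetSum s fun n _ => Measurable.of_discrete (f := h n),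
    Finset.mul_sum]

theorem weightedStep_tsum (h : ℕ → E → ℝ≥0∞) :
    weightedStep P c (fun x => ∑' n, h n x) = fun x => ∑' n, weightedStep P c (h n) x := by
  ext x
  simp only [weightedStep, lintegral_tsum fun n => (Measurable.of_discrete (f := h n)).aemeasurable,
    ENNReal.tsum_mul_left]

theorem weightedStep_iInf_iterate [IsMarkovKernel P] (hc : ∀ x, c x ≤ 1) :
    weightedStep P c (⨅ n, (weightedStep P c)^[n] 1) = ⨅ n, (weightedStep P c)^[n] 1 := by
  have hanti : Antitone fun n => (weightedStep P c)^[n] 1 :=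
    monotone_weightedStep.antitone_iterate_of_map_le fun x => by simpa [weightedStep] using hc x
  have hne_top (x : E) : ∫⁻ y, (weightedStep P c)^[0] 1 y ∂P x ≠ ∞ := by simp
  have hc_top (x : E) : c x ≠ ∞ := ((hc x).trans_lt ENNReal.one_lt_top).ne
  calc weightedStep P c (⨅ n, (weightedStep P c)^[n] 1)
      = ⨅ n, (weightedStep P c)^[n + 1] 1 := by
        ext x
        simp only [weightedStep, iInf_apply, Function.iterate_succ_apply']
        rw [lintegral_iInf (fun n => Measurable.of_discrete) (fun m n h y => hanti h y) (hne_top x),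
          ENNReal.mul_iInf fun h => absurd h (hc_top x)]
    _ = ⨅ n, (weightedStep P c)^[n] 1 := hanti.iInf_nat_add 1

theorem killedPotential_eq (ψ : E → ℝ≥0∞) (x : E) :
    killedPotential P c ψ x = c x * (ψ x + ∫⁻ y, killedPotential P c ψ y ∂P x) := by
  have hstep := congrFun (weightedStep_tsum (P := P) (c := c)
    fun n => (weightedStep P c)^[n] (c * ψ)) x
  calc killedPotential P c ψ x
      = (c * ψ) x + ∑' n, (weightedStep P c)^[n + 1] (c * ψ) x :=
        tsum_eq_zero_add' ENNReal.summable
    _ = c x * ψ x + weightedStep P c (killedPotential P c ψ) x := by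
        simp only [Function.iterate_succ_apply', ← hstep]
        rfl
    _ = c x * (ψ x + ∫⁻ y, killedPotential P c ψ y ∂P x) := (mul_add _ _ _).symm

theorem killedPotential_le_of_supersolution {ψ w : E → ℝ≥0∞}
    (hw : ∀ x, c x * (ψ x + ∫⁻ y, w y ∂P x) ≤ w x) (x : E) : killedPotential P c ψ x ≤ w x := by
  have hpartial (n : ℕ) :
      (fun x => ∑ i ∈ Finset.range n, (weightedStep P c)^[i] (c * ψ) x) ≤ w := by
    induction n with
    | zero => exact fun x => by simp
    | succ n ih =>
      intro x
      refine le_trans ?_ (hw x)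
      have hstep := congrFun (weightedStep_sum (P := P) (c := c) (Finset.range n)
        fun i => (weightedStep P c)^[i] (c * ψ)) x
      simp only [Finset.sum_range_succ', Function.iterate_succ_apply', ← hstep, mul_add]
      rw [add_comm]
      exact add_le_add_right (monotone_weightedStep ih x) _
  exact ENNReal.tsum_le_of_sum_range_le fun n => hpartial n x

theorem killedPotential_mono {ψ φ : E → ℝ≥0∞} (h : ψ ≤ φ) (x : E) :
    killedPotential P c ψ x ≤ killedPotential P c φ x :=
  killedPotential_le_of_supersolution (fun x => by
    rw [killedPotential_eq φ x]
    gcongr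
    exact h x) x

theorem killedPotential_le_of_le_on [IsMarkovKernel P] (hc : ∀ x, c x ≤ 1) {ψ : E → ℝ≥0∞}
    {A : Set E} (hψ : ∀ x ∉ A, ψ x = 0) {C : ℝ≥0∞} (hC : ∀ x ∈ A, killedPotential P c ψ x ≤ C)
    (x : E) : killedPotential P c ψ x ≤ C := by
  refine (killedPotential_le_of_supersolution (w := fun x => min (killedPotential P c ψ x) C)
    (fun x => ?_) x).trans (min_le_right _ _)
  have hle : c x * (ψ x + ∫⁻ y, min (killedPotential P c ψ y) C ∂P x) ≤
      killedPotential P c ψ x := by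
    rw [killedPotential_eq ψ x]
    gcongr
    exact min_le_left _ _
  refine le_min hle ?_
  by_cases hx : x ∈ A
  · exact hle.trans (hC x hx)
  · calc c x * (ψ x + ∫⁻ y, min (killedPotential P c ψ y) C ∂P x)
        ≤ 1 * (0 + ∫⁻ _, C ∂P x) := by
          rw [hψ x hx]
          gcongr
          · exact hc x
          · exact min_le_right _ _
      _ = C := by simp

theorem toReal_killedPotential_eq {ψ : E → ℝ≥0∞} {x : E} (hx : c x = 1)
    (hfin : killedPotential P c ψ x ≠ ∞) :
    (killedPotential P c ψ x).toReal =
      (ψ x).toReal + ∫ y, (killedPotential P c ψ y).toReal ∂P x := by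
  have heq := killedPotential_eq (P := P) (c := c) ψ x
  rw [hx, one_mul] at heq
  obtain ⟨hψ, hint⟩ := ENNReal.add_ne_top.1 (heq ▸ hfin)
  rw [heq, ENNReal.toReal_add hψ hint, integral_toReal Measurable.of_discrete.aemeasurable
    (ae_lt_top Measurable.of_discrete hint)]

/-- The solution is the difference of the potentials of the positive and the negative part of
`h`. -/
theorem exists_bounded_poisson_solution [IsFiniteKernel P] {h : E → ℝ} {C : ℝ≥0∞} (hC : C ≠ ∞)
    (hbound : ∀ x, killedPotential P c (fun y => ENNReal.ofReal |h y|) x ≤ C) :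
    ∃ f : E → ℝ, (∀ x, |f x| ≤ C.toReal) ∧ ∀ x, c x = 1 → f x - ∫ y, f y ∂P x = h x := by
  let V : (E → ℝ) → E → ℝ := fun h x =>
    (killedPotential P c (fun y => ENNReal.ofReal (h y)) x).toReal
  have hle {k : E → ℝ} (hk : ∀ y, k y ≤ |h y|) (x : E) :
      killedPotential P c (fun y => ENNReal.ofReal (k y)) x ≤ C :=
    (killedPotential_mono (fun y => ENNReal.ofReal_le_ofReal (hk y)) x).trans (hbound x)
  have hV {k : E → ℝ} (hk : ∀ y, k y ≤ |h y|) (x : E) : V k x ≤ C.toReal :=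
    ENNReal.toReal_mono hC (hle hk x)
  have hV_int {k : E → ℝ} (hk : ∀ y, k y ≤ |h y|) (x : E) : Integrable (V k) (P x) :=
    .of_bound Measurable.of_discrete.aestronglyMeasurable C.toReal <| .of_forall fun y => by
      rw [Real.norm_of_nonneg ENNReal.toReal_nonneg]
      exact hV hk y
  have hV_eq {k : E → ℝ} (hk : ∀ y, k y ≤ |h y|) {x : E} (hx : c x = 1) :
      V k x = (ENNReal.ofReal (k x)).toReal + ∫ y, V k y ∂P x :=
    toReal_killedPotential_eq hx ((hle hk x).trans_lt hC.lt_top).ne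
  have hpos (y : E) : h y ≤ |h y| := le_abs_self _
  have hneg (y : E) : -h y ≤ |h y| := neg_le_abs _
  refine ⟨fun x => V h x - V (-h) x, fun x => ?_, fun x hx => ?_⟩
  · exact abs_sub_le_of_nonneg_of_le ENNReal.toReal_nonneg (hV hpos x) ENNReal.toReal_nonneg
      (hV hneg x)
  · have hparts : (ENNReal.ofReal (h x)).toReal - (ENNReal.ofReal (-h x)).toReal = h x := by
      rw [ENNReal.toReal_ofReal', ENNReal.toReal_ofReal']
      exact max_zero_sub_eq_self (h x)
    simp only
    rw [integral_sub (hV_int hpos x) (hV_int (k := -h) hneg x), hV_eq hpos hx,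
      hV_eq (k := -h) hneg hx, Pi.neg_apply]
    linarith

end Potential

namespace TransitionRates

section JumpChain

variable {E : Type*} [MeasurableSpace E] [DiscreteMeasurableSpace E] (Q : TransitionRates E)

/-- The transition kernel of the jump chain. -/
def jumpKernel : Kernel E E where
  toFun := Q.jumpMeasure
  measurable' := Measurable.of_discrete

instance : IsMarkovKernel Q.jumpKernel :=
  ⟨fun η => inferInstanceAs (IsProbabilityMeasure (Q.jumpMeasure η))⟩

instance (η : E) : IsProbabilityMeasure (Q.jumpChainLaw η) := by
  unfold jumpChainLaw
  infer_instance

theorem jumpChainLaw_map_frestrictLe_succ (η : E) (n : ℕ) :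
    (Q.jumpChainLaw η).map (fun y => (Preorder.frestrictLe (π := fun _ : ℕ => E) n y, y (n + 1))) =
      ((Q.jumpChainLaw η).map (Preorder.frestrictLe (π := fun _ : ℕ => E) n)) ⊗ₘ Q.jumpStep n := by
  rw [jumpChainLaw, Kernel.traj_map_frestrictLe_apply,
    Kernel.partialTraj_compProd_eq_map_traj (Nat.zero_le n)]

variable [Countable E]

theorem ae_jumpChainLaw_zero_eq (η : E) : ∀ᵐ y ∂Q.jumpChainLaw η, y 0 = η := by
  have hlaw := Kernel.traj_map_frestrictLe_apply (X := fun _ => E) (κ := Q.jumpStep) 0 0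
    (fun _ => η)
  rw [Kernel.partialTraj_self, Kernel.id_apply] at hlaw
  have hdirac : ∀ᵐ z ∂(Q.jumpChainLaw η).map (Preorder.frestrictLe (π := fun _ : ℕ => E) 0),
      z ⟨0, Finset.mem_Iic.2 le_rfl⟩ = η := by
    rw [jumpChainLaw, hlaw, ae_dirac_eq]
    rfl
  exact ae_of_ae_map (by fun_prop) hdirac

theorem lintegral_mul_jumpChainLaw_succ (η : E) {n : ℕ} {G : (ℕ → E) → ℝ≥0∞}
    (hG : DependsOn G (Set.Iic n)) (h : E → ℝ≥0∞) :
    ∫⁻ y, G y * h (y (n + 1)) ∂Q.jumpChainLaw η =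
      ∫⁻ y, G y * ∫⁻ x, h x ∂Q.jumpKernel (y n) ∂Q.jumpChainLaw η := by
  rw [← Finset.coe_Iic] at hG
  obtain ⟨G', rfl⟩ := dependsOn_iff_exists_comp.1 hG
  have hmeas : Measurable fun p : ((i : Finset.Iic n) → E) × E => G' p.1 * h p.2 :=
    (Measurable.of_discrete.comp measurable_fst).mul (Measurable.of_discrete.comp measurable_snd)
  have hpair : Measurable fun y : ℕ → E =>
    (Preorder.frestrictLe (π := fun _ : ℕ => E) n y, y (n + 1)) := by fun_prop
  calc ∫⁻ y, G' ((Finset.Iic n : Set ℕ).domRestrict y) * h (y (n + 1)) ∂Q.jumpChainLaw η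
      = ∫⁻ p, G' p.1 * h p.2 ∂((Q.jumpChainLaw η).map
          fun y => (Preorder.frestrictLe (π := fun _ : ℕ => E) n y, y (n + 1))) :=
        (lintegral_map hmeas hpair).symm
    _ = ∫⁻ y, ∫⁻ x, G' (Preorder.frestrictLe (π := fun _ : ℕ => E) n y) * h x
          ∂Q.jumpKernel (y n) ∂Q.jumpChainLaw η := by
        rw [jumpChainLaw_map_frestrictLe_succ, Measure.lintegral_compProd hmeas,
          lintegral_map hmeas.lintegral_kernel_prod_right' (by fun_prop)]
        rfl
    _ = _ := lintegral_congr fun y => lintegral_const_mul _ Measurable.of_discrete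

theorem integral_mul_jumpChainLaw_succ (η : E) {n : ℕ} {G : (ℕ → E) → ℝ}
    (hG : DependsOn G (Set.Iic n)) {h : E → ℝ} {B C : ℝ} (hB : ∀ y, |G y| ≤ B)
    (hC : ∀ x, |h x| ≤ C) :
    ∫ y, G y * h (y (n + 1)) ∂Q.jumpChainLaw η =
      ∫ y, G y * ∫ x, h x ∂Q.jumpKernel (y n) ∂Q.jumpChainLaw η := by
  rw [← Finset.coe_Iic] at hG
  obtain ⟨G', rfl⟩ := dependsOn_iff_exists_comp.1 hG
  have hmeas : Measurable fun p : ((i : Finset.Iic n) → E) × E => G' p.1 * h p.2 :=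
    (Measurable.of_discrete.comp measurable_fst).mul (Measurable.of_discrete.comp measurable_snd)
  have hpair : Measurable fun y : ℕ → E =>
    (Preorder.frestrictLe (π := fun _ : ℕ => E) n y, y (n + 1)) := by fun_prop
  have hint : Integrable (fun p => G' p.1 * h p.2) ((Q.jumpChainLaw η).map
      fun y => (Preorder.frestrictLe (π := fun _ : ℕ => E) n y, y (n + 1))) := by
    rw [integrable_map_measure hmeas.aestronglyMeasurable hpair.aemeasurable]
    refine .of_bound (hmeas.comp hpair).aestronglyMeasurable (B * C) (.of_forall fun y => ?_)
    rw [Real.norm_eq_abs, Function.comp_apply, abs_mul]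
    exact mul_le_mul (hB y) (hC _) (abs_nonneg _) ((abs_nonneg _).trans (hB y))
  calc ∫ y, G' ((Finset.Iic n : Set ℕ).domRestrict y) * h (y (n + 1)) ∂Q.jumpChainLaw η
      = ∫ p, G' p.1 * h p.2 ∂((Q.jumpChainLaw η).map
          fun y => (Preorder.frestrictLe (π := fun _ : ℕ => E) n y, y (n + 1))) :=
        (integral_map hpair.aemeasurable hmeas.aestronglyMeasurable).symm
    _ = ∫ y, ∫ x, G' (Preorder.frestrictLe (π := fun _ : ℕ => E) n y) * h x
          ∂Q.jumpKernel (y n) ∂Q.jumpChainLaw η := by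
        rw [jumpChainLaw_map_frestrictLe_succ] at hint ⊢
        rw [Measure.integral_compProd hint, integral_map (by fun_prop)
          Measurable.of_discrete.aestronglyMeasurable]
        rfl
    _ = _ := integral_congr_ae (.of_forall fun y => integral_const_mul _ _)

theorem lintegral_prod_mul_jumpChainLaw (η : E) (c h : E → ℝ≥0∞) (m n : ℕ) :
    ∫⁻ y, (∏ i ∈ Finset.range n, c (y (m + i))) * h (y (m + n)) ∂Q.jumpChainLaw η =
      ∫⁻ y, (weightedStep Q.jumpKernel c)^[n] h (y m) ∂Q.jumpChainLaw η := by
  induction n generalizing h with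
  | zero => simp
  | succ n ih =>
    have hdep : DependsOn (fun y : ℕ → E => ∏ i ∈ Finset.range (n + 1), c (y (m + i)))
        (Set.Iic (m + n)) := fun y y' hyy' =>
      Finset.prod_congr rfl fun i hi => by
        rw [hyy' (m + i) (Set.mem_Iic.2 (by have := Finset.mem_range.1 hi; omega))]
    rw [← add_assoc, lintegral_mul_jumpChainLaw_succ Q η hdep, Function.iterate_succ_apply, ← ih]
    simp only [Finset.prod_range_succ, mul_assoc, weightedStep]

theorem lintegral_prod_mul_jumpChainLaw_zero (η : E) (c h : E → ℝ≥0∞) (n : ℕ) :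
    ∫⁻ y, (∏ i ∈ Finset.range n, c (y i)) * h (y n) ∂Q.jumpChainLaw η =
      (weightedStep Q.jumpKernel c)^[n] h η := by
  have hFK := Q.lintegral_prod_mul_jumpChainLaw η c h 0 n
  simp only [zero_add] at hFK
  rw [hFK, lintegral_congr_ae (g := fun _ => (weightedStep Q.jumpKernel c)^[n] h η)
    ((Q.ae_jumpChainLaw_zero_eq η).mono fun y hy => by simp only [hy]), lintegral_const,
    measure_univ, mul_one]

theorem lintegral_jumpChainLaw_one (η : E) (h : E → ℝ≥0∞) :
    ∫⁻ y, h (y 1) ∂Q.jumpChainLaw η = ∫⁻ x, h x ∂Q.jumpKernel η := by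
  simpa [weightedStep] using Q.lintegral_prod_mul_jumpChainLaw_zero η 1 h 1

variable {Q}

theorem IsRecurrent.iInf_lintegral_iterate_avoid (hrec : Q.IsRecurrent) (η : E) :
    ⨅ n, ∫⁻ x, (weightedStep Q.jumpKernel (({η} : Set E)ᶜ.indicator 1))^[n] 1 x ∂Q.jumpKernel η =
      0 := by
  let c : E → ℝ≥0∞ := ({η} : Set E)ᶜ.indicator 1
  let D : ℕ → (ℕ → E) → ℝ≥0∞ := fun n y => ∏ i ∈ Finset.range n, c (y (1 + i))
  have hD_meas (n : ℕ) : Measurable (D n) :=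
    Finset.measurable_prod _ fun i _ =>
      (Measurable.of_discrete (f := c)).comp (measurable_pi_apply (1 + i))
  have hD_anti : Antitone D := antitone_nat_of_succ_le fun n y => by
    simp only [D, Finset.prod_range_succ]
    exact mul_le_of_le_one_right' (Set.indicator_le_self' (fun _ _ => zero_le_one) _)
  have hD_zero : ∀ᵐ y ∂Q.jumpChainLaw η, ⨅ n, D n y = 0 := by
    filter_upwards [hrec η] with y ⟨n, hn, hy⟩
    refine le_antisymm ((iInf_le _ n).trans_eq ?_) zero_le
    exact Finset.prod_eq_zero (i := n - 1) (Finset.mem_range.2 (by omega))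
      (by simp [c, Nat.add_sub_cancel' hn, hy])
  calc ⨅ n, ∫⁻ x, (weightedStep Q.jumpKernel c)^[n] 1 x ∂Q.jumpKernel η
      = ⨅ n, ∫⁻ y, D n y ∂Q.jumpChainLaw η := by
        refine iInf_congr fun n => ?_
        rw [← lintegral_jumpChainLaw_one, ← lintegral_prod_mul_jumpChainLaw]
        simp [D]
    _ = ∫⁻ y, ⨅ n, D n y ∂Q.jumpChainLaw η := by
        rw [lintegral_iInf hD_meas hD_anti (by simp [D])]
    _ = 0 := lintegral_eq_zero_of_ae_eq_zero hD_zero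

theorem IsRecurrent.lintegral_jumpKernel_le (hrec : Q.IsRecurrent) {u : E → ℝ≥0∞}
    (hu : ∀ x, u x ≤ 1) (hsub : ∀ x, u x ≤ ∫⁻ y, u y ∂Q.jumpKernel x) (η : E) :
    ∫⁻ x, u x ∂Q.jumpKernel η ≤ u η := by
  let W : ℕ → E → ℝ≥0∞ := fun n => (weightedStep Q.jumpKernel (({η} : Set E)ᶜ.indicator 1))^[n] 1
  calc ∫⁻ x, u x ∂Q.jumpKernel η
      ≤ ⨅ n, (u η + ∫⁻ x, W n x ∂Q.jumpKernel η) := le_iInf fun n =>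
        (lintegral_mono (le_add_iterate_weightedStep hu hsub n)).trans_eq <| by
          rw [lintegral_add_left measurable_const, lintegral_const, measure_univ, mul_one]
    _ = u η := by rw [← ENNReal.add_iInf, hrec.iInf_lintegral_iterate_avoid, add_zero]

theorem IsRecurrent.iInf_iterate_weightedStep_eq_zero (hrec : Q.IsRecurrent) {c : E → ℝ≥0∞}
    (hc : ∀ x, c x < 1) : ⨅ n, (weightedStep Q.jumpKernel c)^[n] 1 = 0 := by
  set w := ⨅ n, (weightedStep Q.jumpKernel c)^[n] 1
  have hfix (x : E) : w x = c x * ∫⁻ y, w y ∂Q.jumpKernel x :=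
    (congrFun (weightedStep_iInf_iterate fun x => (hc x).le) x).symm
  have hw_le (x : E) : w x ≤ 1 := (iInf_le (fun n => (weightedStep Q.jumpKernel c)^[n] 1) 0) x
  have hsub (x : E) : w x ≤ ∫⁻ y, w y ∂Q.jumpKernel x :=
    (hfix x).trans_le (mul_le_of_le_one_left' (hc x).le)
  ext η
  by_contra hne
  have hlt : c η * w η < 1 * w η := by
    gcongr
    · exact ((hw_le η).trans_lt ENNReal.one_lt_top).ne
    · exact hc η
  refine absurd (hfix η) (ne_of_gt (lt_of_le_of_lt ?_ (one_mul (w η) ▸ hlt)))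
  gcongr
  exact hrec.lintegral_jumpKernel_le hw_le hsub η

end JumpChain

section Paths

variable {E : Type*} (Q : TransitionRates E)

/-- The time `∑_{i < n} e_i / λ(Y_i)` of the `n`-th jump, so that the chain sits in `Y_n` during
`[jumpTime ω n, jumpTime ω (n + 1))`. -/
def jumpTime (ω : (ℕ → E) × (ℕ → ℝ)) (n : ℕ) : ℝ :=
  ∑ i ∈ Finset.range n, ω.2 i / Q.holdingRate (ω.1 i)

variable {Q}

theorem process_eq_of_mem_Ico {ω : (ℕ → E) × (ℕ → ℝ)} (hω : Monotone (Q.jumpTime ω)) {n : ℕ}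
    {s : ℝ} (hs : s ∈ Set.Ico (Q.jumpTime ω n) (Q.jumpTime ω (n + 1))) :
    Q.process s ω = ω.1 n := by
  have hn : Q.jumpIndex s ω = n := by
    refine le_antisymm (Nat.sInf_le hs.2) (le_csInf ⟨n, hs.2⟩ fun m hm => ?_)
    by_contra! hmn
    exact absurd (hs.1.trans_lt hm) (not_lt.2 (hω (Nat.succ_le_of_lt hmn)))
  rw [process, hn]

theorem iUnion_Ico_jumpTime {ω : (ℕ → E) × (ℕ → ℝ)} (hω : Monotone (Q.jumpTime ω))
    (hlim : ¬BddAbove (Set.range (Q.jumpTime ω))) :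
    ⋃ n, Set.Ico (Q.jumpTime ω n) (Q.jumpTime ω (n + 1)) = Set.Ici 0 := by
  have h := iUnion_Ico_map_succ_eq_Ici (fun n => hω (Nat.zero_le n)) hlim
  simpa only [Nat.bot_eq_zero, Nat.succ_eq_succ, Nat.succ_eq_add_one, jumpTime,
    Finset.range_zero, Finset.sum_empty] using h

theorem ofReal_jumpTime_le_hittingTime {ω : (ℕ → E) × (ℕ → ℝ)} (hω : Monotone (Q.jumpTime ω))
    (hlim : ¬BddAbove (Set.range (Q.jumpTime ω))) {ξ : E} {n : ℕ}
    (hn : ∀ i < n, ω.1 i ≠ ξ) : ENNReal.ofReal (Q.jumpTime ω n) ≤ Q.hittingTime ξ ω := by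
  refine le_iInf₂ fun s ⟨hs, hsξ⟩ => ENNReal.ofReal_le_ofReal ?_
  by_contra! hlt
  obtain ⟨m, hm⟩ := Set.mem_iUnion.1 ((iUnion_Ico_jumpTime hω hlim).ge hs.le)
  refine hn m ?_ (process_eq_of_mem_Ico hω hm ▸ hsξ)
  exact hω.reflect_lt (hm.1.trans_lt hlt)

theorem setLIntegral_process {ω : (ℕ → E) × (ℕ → ℝ)} (hω : Monotone (Q.jumpTime ω))
    (hlim : ¬BddAbove (Set.range (Q.jumpTime ω))) {B : Set ℝ}
    (hB : MeasurableSet B) (hB0 : B ⊆ Set.Ici 0) (φ : E → ℝ≥0∞) :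
    ∫⁻ s in B, φ (Q.process s ω) =
      ∑' n, φ (ω.1 n) * volume (Set.Ico (Q.jumpTime ω n) (Q.jumpTime ω (n + 1)) ∩ B) := by
  let I : ℕ → Set ℝ := fun n => Set.Ico (Q.jumpTime ω n) (Q.jumpTime ω (n + 1)) ∩ B
  have hI_union : B = ⋃ n, I n := by
    rw [← Set.iUnion_inter, iUnion_Ico_jumpTime hω hlim, Set.inter_eq_right.2 hB0]
  have hI_disj : Pairwise (Function.onFun Disjoint I) :=
    hω.pairwise_disjoint_on_Ico_succ.mono fun _ _ h => h.mono Set.inter_subset_left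
      Set.inter_subset_left
  have hI_meas (n : ℕ) : MeasurableSet (I n) := measurableSet_Ico.inter hB
  calc ∫⁻ s in B, φ (Q.process s ω)
      = ∑' n, ∫⁻ s in I n, φ (Q.process s ω) := by
        conv_lhs => rw [hI_union]
        exact lintegral_iUnion hI_meas hI_disj _
    _ = ∑' n, φ (ω.1 n) * volume (I n) := tsum_congr fun n => by
        rw [setLIntegral_congr_fun (g := fun _ => φ (ω.1 n)) (hI_meas n) fun s hs => by
          simp only [process_eq_of_mem_Ico hω hs.1], setLIntegral_const]

theorem tsum_avoid_mul_holding_le {ω : (ℕ → E) × (ℕ → ℝ)} (hω : Monotone (Q.jumpTime ω))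
    (hlim : ¬BddAbove (Set.range (Q.jumpTime ω))) (ξ : E) (φ : E → ℝ≥0∞) :
    ∑' n, (∏ i ∈ Finset.range (n + 1), ({ξ} : Set E)ᶜ.indicator (1 : E → ℝ≥0∞) (ω.1 i)) *
        φ (ω.1 n) * volume (Set.Ico (Q.jumpTime ω n) (Q.jumpTime ω (n + 1))) ≤
      ∫⁻ s in {s : ℝ | 0 ≤ s ∧ ENNReal.ofReal s < Q.hittingTime ξ ω}, φ (Q.process s ω) := by
  have hmeas : MeasurableSet {s : ℝ | 0 ≤ s ∧ ENNReal.ofReal s < Q.hittingTime ξ ω} := by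
    measurability
  rw [setLIntegral_process hω hlim hmeas fun s hs => hs.1]
  refine ENNReal.tsum_le_tsum fun n => ?_
  by_cases hn : ∀ i < n + 1, ω.1 i ≠ ξ
  · have hbefore : Set.Ico (Q.jumpTime ω n) (Q.jumpTime ω (n + 1)) ⊆
        {s | 0 ≤ s ∧ ENNReal.ofReal s < Q.hittingTime ξ ω} := by
      intro s hs
      have hs0 : 0 ≤ s := (iUnion_Ico_jumpTime hω hlim).le (Set.mem_iUnion.2 ⟨n, hs⟩)
      exact ⟨hs0, ((ENNReal.ofReal_lt_ofReal_iff_of_nonneg hs0).2 hs.2).trans_le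
        (ofReal_jumpTime_le_hittingTime hω hlim hn)⟩
    rw [Finset.prod_eq_one fun i hi => by simp [hn i (Finset.mem_range.1 hi)], one_mul,
      Set.inter_eq_left.2 hbefore]
  · push Not at hn
    obtain ⟨i, hi, hiξ⟩ := hn
    rw [Finset.prod_eq_zero (Finset.mem_range.2 hi) (by simp [hiξ]), zero_mul, zero_mul]
    exact zero_le

variable (Q)

theorem hasLaw_holdingTime (y : ℕ → E) (n : ℕ) :
    HasLaw (fun e : ℕ → ℝ => e n / Q.holdingRate (y n)) (expMeasure (Q.holdingRate (y n)))
      (Measure.infinitePi fun _ : ℕ => expMeasure 1) :=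
  HasLaw.fun_comp ⟨by fun_prop, expMeasure_map_div (Q.holdingRate_pos _)⟩
    (measurePreserving_eval_infinitePi (fun _ : ℕ => expMeasure 1) n).hasLaw

theorem iIndepFun_holdingTime (y : ℕ → E) :
    iIndepFun (fun n (e : ℕ → ℝ) => e n / Q.holdingRate (y n))
      (Measure.infinitePi fun _ : ℕ => expMeasure 1) :=
  iIndepFun_infinitePi (X := fun n x => x / Q.holdingRate (y n)) (by fun_prop)

end Paths

section PathMeasure

variable {E : Type*} [MeasurableSpace E] [DiscreteMeasurableSpace E] (Q : TransitionRates E)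

@[fun_prop]
theorem measurable_jumpTime (n : ℕ) : Measurable fun ω => Q.jumpTime ω n := by
  have : Measurable Q.holdingRate := Measurable.of_discrete
  unfold jumpTime
  fun_prop

instance (η : E) : IsProbabilityMeasure (Q.pathMeasure η) := by
  unfold pathMeasure
  infer_instance

theorem ae_monotone_jumpTime (η : E) : ∀ᵐ ω ∂Q.pathMeasure η, Monotone (Q.jumpTime ω) := by
  have hclock : ∀ᵐ e ∂Measure.infinitePi fun _ : ℕ => expMeasure 1, ∀ n, 0 < e n :=
    ae_all_iff.2 fun n => (measurePreserving_eval_infinitePi (fun _ : ℕ => expMeasure 1)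
      n).quasiMeasurePreserving.ae (ae_expMeasure_pos one_pos)
  filter_upwards [Measure.quasiMeasurePreserving_snd.ae hclock] with ω hω
  refine monotone_nat_of_le_succ fun n => ?_
  rw [jumpTime, jumpTime, Finset.sum_range_succ]
  exact le_add_of_nonneg_right (div_nonneg (hω n).le (Q.holdingRate_pos _).le)

theorem measurable_process :
    Measurable fun p : ((ℕ → E) × (ℕ → ℝ)) × ℝ => Q.process p.2 p.1 := by
  have hindex : Measurable fun p : ((ℕ → E) × (ℕ → ℝ)) × ℝ => Q.jumpIndex p.2 p.1 :=
    measurable_sInf_nat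
      (A := fun n => {p : ((ℕ → E) × (ℕ → ℝ)) × ℝ | p.2 < Q.jumpTime p.1 (n + 1)})
      fun n => measurableSet_lt (by fun_prop) (by fun_prop)
  have heval : Measurable fun p : (ℕ → E) × ℕ => p.1 p.2 :=
    measurable_from_prod_countable_left fun n => measurable_pi_apply n
  exact heval.comp (measurable_fst.fst.prodMk hindex)

theorem lintegral_mul_volume_holding_inter (η : E) (n : ℕ) {G : (ℕ → E) → ℝ≥0∞}
    (hG : Measurable G) {B : Set ℝ} (hB : MeasurableSet B) :
    ∫⁻ ω, G ω.1 * volume (Set.Ico (Q.jumpTime ω n) (Q.jumpTime ω (n + 1)) ∩ B) ∂Q.pathMeasure η =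
      ∫⁻ ω in {ω | Q.jumpTime ω (n + 1) ∈ B},
        G ω.1 * ENNReal.ofReal (1 / Q.holdingRate (ω.1 n)) ∂Q.pathMeasure η := by
  have hset : MeasurableSet {ω | Q.jumpTime ω (n + 1) ∈ B} := Q.measurable_jumpTime (n + 1) hB
  have : Measurable fun x => ENNReal.ofReal (1 / Q.holdingRate x) := Measurable.of_discrete
  have hvol : Measurable fun ω => volume (Set.Ico (Q.jumpTime ω n) (Q.jumpTime ω (n + 1)) ∩ B) :=
    measurable_volume_Ico_inter (by fun_prop) (by fun_prop) hB
  have hclock (y : ℕ → E) :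
      ∫⁻ e, volume (Set.Ico (Q.jumpTime (y, e) n) (Q.jumpTime (y, e) (n + 1)) ∩ B)
          ∂(Measure.infinitePi fun _ : ℕ => expMeasure 1) =
        ENNReal.ofReal (1 / Q.holdingRate (y n)) *
          (Measure.infinitePi fun _ : ℕ => expMeasure 1) {e | Q.jumpTime (y, e) (n + 1) ∈ B} := by
    simpa only [jumpTime, Finset.sum_range_succ, Finset.sum_apply] using
      lintegral_volume_Ico_add_inter (Q.holdingRate_pos (y n)) (by fun_prop)
        (Q.hasLaw_holdingTime y n) ((Q.iIndepFun_holdingTime y).indepFun_finsetSum_of_notMem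
          (by fun_prop) (Finset.notMem_range_self (n := n))) hB
  rw [← lintegral_indicator hset, pathMeasure, lintegral_prod _ (by fun_prop),
    lintegral_prod _ (by fun_prop)]
  refine lintegral_congr fun y => ?_
  have hvol_y : Measurable fun e : ℕ → ℝ =>
      volume (Set.Ico (Q.jumpTime (y, e) n) (Q.jumpTime (y, e) (n + 1)) ∩ B) :=
    hvol.comp measurable_prodMk_left
  have hset_y : MeasurableSet {e : ℕ → ℝ | Q.jumpTime (y, e) (n + 1) ∈ B} :=
    hset.preimage measurable_prodMk_left
  dsimp only
  rw [lintegral_const_mul _ hvol_y, hclock, ← mul_assoc, ← lintegral_indicator_const hset_y]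
  rfl

variable [Countable E]

theorem lintegral_exp_neg_jumpTime (η : E) (n : ℕ) :
    ∫⁻ ω, ENNReal.ofReal (Real.exp (-Q.jumpTime ω n)) ∂Q.pathMeasure η =
      (weightedStep Q.jumpKernel
        fun x => ENNReal.ofReal (Q.holdingRate x / (1 + Q.holdingRate x)))^[n] 1 η := by
  have hexp (ω : (ℕ → E) × (ℕ → ℝ)) : ENNReal.ofReal (Real.exp (-Q.jumpTime ω n)) =
      ∏ i ∈ Finset.range n, ENNReal.ofReal (Real.exp (-(ω.2 i / Q.holdingRate (ω.1 i)))) := by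
    rw [jumpTime, ← Finset.sum_neg_distrib, Real.exp_sum,
      ENNReal.ofReal_prod_of_nonneg fun i _ => (Real.exp_pos _).le]
  rw [← lintegral_prod_mul_jumpChainLaw_zero, pathMeasure, lintegral_prod _ (by fun_prop)]
  refine lintegral_congr fun y => ?_
  simp only [hexp, Pi.one_apply, mul_one]
  refine (lintegral_prod_eq_prod_lintegral_of_indepFun _ _ ((Q.iIndepFun_holdingTime y).comp
    (fun _ x => ENNReal.ofReal (Real.exp (-x))) (by fun_prop)) (by fun_prop)).trans ?_
  exact Finset.prod_congr rfl fun i _ =>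
    ((Q.hasLaw_holdingTime y i).lintegral_comp (f := fun x => ENNReal.ofReal (Real.exp (-x)))
      (by fun_prop)).trans (lintegral_exp_neg_expMeasure (Q.holdingRate_pos (y i)))

variable {Q}

theorem IsRecurrent.ae_not_bddAbove_jumpTime (hrec : Q.IsRecurrent) (η : E) :
    ∀ᵐ ω ∂Q.pathMeasure η, ¬BddAbove (Set.range (Q.jumpTime ω)) := by
  have hlt (x : E) : ENNReal.ofReal (Q.holdingRate x / (1 + Q.holdingRate x)) < 1 := by
    have := Q.holdingRate_pos x
    rw [ENNReal.ofReal_lt_one, div_lt_one (by linarith)]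
    linarith
  have hzero : ∫⁻ ω, ⨅ n, ENNReal.ofReal (Real.exp (-Q.jumpTime ω n)) ∂Q.pathMeasure η = 0 := by
    refine le_antisymm ?_ zero_le
    calc ∫⁻ ω, ⨅ n, ENNReal.ofReal (Real.exp (-Q.jumpTime ω n)) ∂Q.pathMeasure η
        ≤ ⨅ n, ∫⁻ ω, ENNReal.ofReal (Real.exp (-Q.jumpTime ω n)) ∂Q.pathMeasure η :=
          le_iInf fun n => lintegral_mono fun ω => iInf_le _ n
      _ = (⨅ n, (weightedStep Q.jumpKernel
            fun x => ENNReal.ofReal (Q.holdingRate x / (1 + Q.holdingRate x)))^[n] 1) η := by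
          simp only [lintegral_exp_neg_jumpTime, iInf_apply]
      _ = 0 := by rw [hrec.iInf_iterate_weightedStep_eq_zero hlt, Pi.zero_apply]
  filter_upwards [(lintegral_eq_zero_iff (by fun_prop)).1 hzero] with ω hω
  rintro ⟨K, hK⟩
  have hpos : ENNReal.ofReal (Real.exp (-K)) ≤ ⨅ n, ENNReal.ofReal (Real.exp (-Q.jumpTime ω n)) :=
    le_iInf fun n => ENNReal.ofReal_le_ofReal
      (Real.exp_le_exp.2 (neg_le_neg (hK (Set.mem_range_self n))))
  rw [hω] at hpos
  exact (ENNReal.ofReal_pos.2 (Real.exp_pos _)).not_ge hpos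

end PathMeasure

section HittingTime

variable {E : Type*} [Countable E] [MeasurableSpace E] [DiscreteMeasurableSpace E]
  {Q : TransitionRates E}

theorem IsRecurrent.killedPotential_le_expAbsIntegralUntilHit (hrec : Q.IsRecurrent)
    (g : E → ℝ) (ξ η : E) :
    killedPotential Q.jumpKernel (({ξ} : Set E)ᶜ.indicator 1)
      (fun x => ENNReal.ofReal |g x / Q.holdingRate x|) η ≤ Q.expAbsIntegralUntilHit g ξ η := by
  let c : E → ℝ≥0∞ := ({ξ} : Set E)ᶜ.indicator 1
  let φ : E → ℝ≥0∞ := fun x => ENNReal.ofReal |g x|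
  let G : ℕ → (ℕ → E) → ℝ≥0∞ := fun n y => (∏ i ∈ Finset.range (n + 1), c (y i)) * φ (y n)
  have hc : Measurable c := Measurable.of_discrete
  have hφ : Measurable φ := Measurable.of_discrete
  have : Measurable fun x => ENNReal.ofReal (1 / Q.holdingRate x) := Measurable.of_discrete
  have hG (n : ℕ) : Measurable (G n) := by fun_prop
  have hvol (n : ℕ) : Measurable fun ω =>
      volume (Set.Ico (Q.jumpTime ω n) (Q.jumpTime ω (n + 1)) ∩ Set.univ) :=
    measurable_volume_Ico_inter (by fun_prop) (by fun_prop) MeasurableSet.univ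
  have habs (x : E) : ENNReal.ofReal |g x / Q.holdingRate x| =
      φ x * ENNReal.ofReal (1 / Q.holdingRate x) := by
    rw [abs_div, abs_of_pos (Q.holdingRate_pos x), div_eq_mul_one_div,
      ENNReal.ofReal_mul (abs_nonneg _)]
  have hterm (n : ℕ) : (weightedStep Q.jumpKernel c)^[n]
      (c * fun x => ENNReal.ofReal |g x / Q.holdingRate x|) η =
      ∫⁻ ω, G n ω.1 * volume (Set.Ico (Q.jumpTime ω n) (Q.jumpTime ω (n + 1)) ∩ Set.univ)
        ∂Q.pathMeasure η := by
    rw [Q.lintegral_mul_volume_holding_inter η n (hG n) MeasurableSet.univ,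
      ← lintegral_prod_mul_jumpChainLaw_zero]
    simp only [Set.mem_univ, Set.ofPred_true, Measure.restrict_univ]
    rw [pathMeasure, measurePreserving_fst.lintegral_comp
      (f := fun y : ℕ → E => G n y * ENNReal.ofReal (1 / Q.holdingRate (y n))) (by fun_prop)]
    simp only [G, Pi.mul_apply, habs, Finset.prod_range_succ, mul_assoc]
  calc killedPotential Q.jumpKernel c (fun x => ENNReal.ofReal |g x / Q.holdingRate x|) η
      = ∫⁻ ω, ∑' n, G n ω.1 *
          volume (Set.Ico (Q.jumpTime ω n) (Q.jumpTime ω (n + 1)) ∩ Set.univ)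
          ∂Q.pathMeasure η := by
        rw [lintegral_tsum fun n => Measurable.aemeasurable (by fun_prop)]
        exact tsum_congr hterm
    _ ≤ Q.expAbsIntegralUntilHit g ξ η := by
        refine lintegral_mono_ae ?_
        filter_upwards [Q.ae_monotone_jumpTime η, hrec.ae_not_bddAbove_jumpTime η] with ω hω hlim
        simp only [Set.inter_univ]
        exact tsum_avoid_mul_holding_le hω hlim ξ φ

end HittingTime

section OccupationKernel

variable {E : Type*} [MeasurableSpace E] [DiscreteMeasurableSpace E] (Q : TransitionRates E)

/-- The kernel sending `η` to the expected time `E_η[∫_0^t 1{η_s ∈ ·} ds]` spent in each set of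
states up to time `t`. -/
def occupationKernel (t : ℝ) : Kernel E E where
  toFun η := ((Q.pathMeasure η).prod (volume.restrict (Set.Icc 0 t))).map fun p =>
    Q.process p.2 p.1
  measurable' := Measurable.of_discrete

theorem occupationKernel_apply (t : ℝ) (η : E) : Q.occupationKernel t η =
    ((Q.pathMeasure η).prod (volume.restrict (Set.Icc 0 t))).map fun p => Q.process p.2 p.1 :=
  rfl

theorem lintegral_occupationKernel (t : ℝ) (η : E) (φ : E → ℝ≥0∞) :
    ∫⁻ x, φ x ∂Q.occupationKernel t η =
      ∫⁻ ω, (∫⁻ s in Set.Icc 0 t, φ (Q.process s ω)) ∂Q.pathMeasure η := by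
  have hφ : Measurable φ := Measurable.of_discrete
  rw [occupationKernel_apply, lintegral_map hφ Q.measurable_process]
  exact lintegral_prod _ (hφ.comp Q.measurable_process).aemeasurable

theorem integrable_occupationKernel_iff {g : E → ℝ} {t : ℝ} {η : E} :
    Integrable g (Q.occupationKernel t η) ↔ Q.TimeIntegrable g t η :=
  integrable_map_measure Measurable.of_discrete.aestronglyMeasurable
    Q.measurable_process.aemeasurable

theorem expTimeIntegral_eq_integral_occupationKernel {g : E → ℝ} {t : ℝ} (ht : 0 ≤ t) {η : E}
    (hg : Integrable g (Q.occupationKernel t η)) :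
    Q.expTimeIntegral g t η = ∫ x, g x ∂Q.occupationKernel t η := by
  rw [occupationKernel_apply, integral_map Q.measurable_process.aemeasurable
    Measurable.of_discrete.aestronglyMeasurable,
    integral_prod _ (Q.integrable_occupationKernel_iff.1 hg)]
  simp only [expTimeIntegral, intervalIntegral.integral_of_le ht,
    integral_Icc_eq_integral_Ioc]

variable [Countable E] {Q}

/-- Given the jump chain and the first `n` clocks, the expected length of the `n`-th holding
interval within `[0, t]` is `1 / λ(Y_n)` times the probability that this interval ends before
`t`. -/
theorem IsRecurrent.occupationKernel_eq_sum (hrec : Q.IsRecurrent) (t : ℝ) (η : E) :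
    Q.occupationKernel t η = Measure.sum fun n =>
      (((Q.pathMeasure η).restrict {ω | Q.jumpTime ω (n + 1) ∈ Set.Icc 0 t}).map
        fun ω => ω.1 n).withDensity fun x => ENNReal.ofReal (1 / Q.holdingRate x) := by
  have hrate : Measurable fun x => ENNReal.ofReal (1 / Q.holdingRate x) := Measurable.of_discrete
  refine Measure.ext_of_lintegral _ fun φ hφ => ?_
  have hterm (n : ℕ) : Measurable fun ω : (ℕ → E) × (ℕ → ℝ) => φ (ω.1 n) *
      volume (Set.Ico (Q.jumpTime ω n) (Q.jumpTime ω (n + 1)) ∩ Set.Icc 0 t) :=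
    Measurable.mul (by fun_prop)
      (measurable_volume_Ico_inter (by fun_prop) (by fun_prop) measurableSet_Icc)
  calc ∫⁻ x, φ x ∂Q.occupationKernel t η
      = ∫⁻ ω : (ℕ → E) × (ℕ → ℝ), ∑' n, φ (ω.1 n) *
          volume (Set.Ico (Q.jumpTime ω n) (Q.jumpTime ω (n + 1)) ∩ Set.Icc 0 t)
          ∂Q.pathMeasure η := by
        rw [lintegral_occupationKernel]
        refine lintegral_congr_ae ?_
        filter_upwards [Q.ae_monotone_jumpTime η, hrec.ae_not_bddAbove_jumpTime η] with ω hω hlim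
        exact setLIntegral_process hω hlim measurableSet_Icc Set.Icc_subset_Ici_self φ
    _ = ∑' n, ∫⁻ ω in {ω | Q.jumpTime ω (n + 1) ∈ Set.Icc 0 t},
          φ (ω.1 n) * ENNReal.ofReal (1 / Q.holdingRate (ω.1 n)) ∂Q.pathMeasure η := by
        rw [lintegral_tsum fun n => (hterm n).aemeasurable]
        exact tsum_congr fun n => Q.lintegral_mul_volume_holding_inter η n
          (G := fun y => φ (y n)) (by fun_prop) measurableSet_Icc
    _ = _ := by
        rw [lintegral_sum_measure]
        refine tsum_congr fun n => ?_
        rw [lintegral_withDensity_eq_lintegral_mul _ hrate hφ, lintegral_map (by fun_prop)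
          (by fun_prop)]
        simp only [Pi.mul_apply, mul_comm]

theorem IsRecurrent.hasSum_integral_occupationKernel (hrec : Q.IsRecurrent) {t : ℝ} {η : E}
    {g : E → ℝ} (hg : Integrable g (Q.occupationKernel t η)) :
    HasSum (fun n => ∫ ω in {ω | Q.jumpTime ω (n + 1) ∈ Set.Icc 0 t},
      g (ω.1 n) / Q.holdingRate (ω.1 n) ∂Q.pathMeasure η) (∫ x, g x ∂Q.occupationKernel t η) := by
  rw [hrec.occupationKernel_eq_sum] at hg ⊢
  refine (hasSum_integral_measure hg).congr_fun fun n => ?_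
  rw [integral_withDensity_eq_integral_toReal_smul Measurable.of_discrete
    (.of_forall fun _ => ENNReal.ofReal_lt_top),
    integral_map (Measurable.aemeasurable (by fun_prop))
      Measurable.of_discrete.aestronglyMeasurable]
  refine integral_congr_ae (.of_forall fun ω => ?_)
  simp only [ENNReal.toReal_ofReal (one_div_nonneg.2 (Q.holdingRate_pos (ω.1 n)).le), smul_eq_mul]
  ring

end OccupationKernel

section Dynkin

variable {E : Type*} [MeasurableSpace E] [DiscreteMeasurableSpace E] (Q : TransitionRates E)

theorem integrable_comp_eval_pathMeasure (η : E) {h : E → ℝ} {C : ℝ}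
    (hh : ∀ x, |h x| ≤ C) (n : ℕ) : Integrable (fun ω => h (ω.1 n)) (Q.pathMeasure η) := by
  have hmeas : Measurable fun ω : (ℕ → E) × (ℕ → ℝ) => h (ω.1 n) := by
    have : Measurable h := Measurable.of_discrete
    fun_prop
  exact Integrable.of_bound hmeas.aestronglyMeasurable C
    (.of_forall fun ω => hh (ω.1 n))

theorem setIntegral_jumpTime_mem (η : E) (m n : ℕ) {h : E → ℝ} {C : ℝ}
    (hh : ∀ x, |h x| ≤ C) {B : Set ℝ} (hB : MeasurableSet B) :
    ∫ ω in {ω | Q.jumpTime ω n ∈ B}, h (ω.1 m) ∂Q.pathMeasure η =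
      ∫ e, (∫ y, {y | Q.jumpTime (y, e) n ∈ B}.indicator 1 y * h (y m) ∂Q.jumpChainLaw η)
        ∂(Measure.infinitePi fun _ : ℕ => expMeasure 1) := by
  have hset : MeasurableSet {ω | Q.jumpTime ω n ∈ B} := Q.measurable_jumpTime n hB
  rw [← integral_indicator hset, pathMeasure,
    integral_prod_symm _ ((Q.integrable_comp_eval_pathMeasure η hh m).indicator hset)]
  refine integral_congr_ae (.of_forall fun e => integral_congr_ae
    (.of_forall fun y => ?_))
  by_cases hy : Q.jumpTime (y, e) n ∈ B <;> simp [hy]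

theorem abs_integral_jumpKernel_le {f : E → ℝ} {C : ℝ}
    (hf : ∀ x, |f x| ≤ C) (x : E) : |∫ y, f y ∂Q.jumpKernel x| ≤ C := by
  simpa using norm_integral_le_of_norm_le_const (μ := Q.jumpKernel x) (f := f)
    (.of_forall hf)

theorem ae_norm_sum_indicator_jumpTime_mem_le (η : E) {f : E → ℝ} {C : ℝ} (hf : ∀ x, |f x| ≤ C)
    (t : ℝ) (N : ℕ) : ∀ᵐ ω ∂Q.pathMeasure η,
      ‖∑ n ∈ Finset.range N, {ω | Q.jumpTime ω (n + 1) ∈ Set.Icc 0 t}.indicator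
        (fun ω => f (ω.1 n) - f (ω.1 (n + 1))) ω‖ ≤ 2 * C := by
  filter_upwards [Q.ae_monotone_jumpTime η] with ω hω
  have hlower : IsLowerSet {n | Q.jumpTime ω (n + 1) ∈ Set.Icc 0 t} := fun m n hnm hm =>
    ⟨(by simp [jumpTime] : 0 ≤ Q.jumpTime ω 0).trans (hω (Nat.zero_le _)),
      (hω (Nat.succ_le_succ hnm)).trans hm.2⟩
  obtain ⟨k, hk⟩ := exists_sum_range_indicator_sub_eq (fun n => f (ω.1 n)) hlower N
  calc ‖∑ n ∈ Finset.range N, {ω | Q.jumpTime ω (n + 1) ∈ Set.Icc 0 t}.indicator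
        (fun ω => f (ω.1 n) - f (ω.1 (n + 1))) ω‖
      = |f (ω.1 0) - f (ω.1 k)| := congrArg abs hk
    _ ≤ |f (ω.1 0)| + |f (ω.1 k)| := abs_sub _ _
    _ ≤ 2 * C := by linarith [hf (ω.1 0), hf (ω.1 k)]

variable [Countable E]

theorem setIntegral_jumpTime_mem_succ (η : E) (n : ℕ) {f : E → ℝ} {C : ℝ}
    (hf : ∀ x, |f x| ≤ C) {B : Set ℝ} (hB : MeasurableSet B) :
    ∫ ω in {ω | Q.jumpTime ω (n + 1) ∈ B}, f (ω.1 (n + 1)) ∂Q.pathMeasure η =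
      ∫ ω in {ω | Q.jumpTime ω (n + 1) ∈ B}, (∫ x, f x ∂Q.jumpKernel (ω.1 n))
        ∂Q.pathMeasure η := by
  rw [Q.setIntegral_jumpTime_mem η (n + 1) (n + 1) hf hB,
    Q.setIntegral_jumpTime_mem η n (n + 1) (h := fun x => ∫ y, f y ∂Q.jumpKernel x)
      (Q.abs_integral_jumpKernel_le hf) hB]
  refine integral_congr_ae (.of_forall fun e =>
    Q.integral_mul_jumpChainLaw_succ η (B := 1) ?_ ?_ hf)
  · intro y y' hy
    have htime : Q.jumpTime (y, e) (n + 1) = Q.jumpTime (y', e) (n + 1) :=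
      Finset.sum_congr rfl fun i hi => by
        dsimp only
        rw [hy i (Nat.lt_succ_iff.1 (Finset.mem_range.1 hi))]
    by_cases hmem : Q.jumpTime (y', e) (n + 1) ∈ B <;> simp [hmem, htime]
  · intro y
    by_cases hy : Q.jumpTime (y, e) (n + 1) ∈ B <;> simp [hy]

variable {Q}

theorem abs_integral_occupationKernel_le (hrec : Q.IsRecurrent) {t : ℝ} {η : E} {f g : E → ℝ}
    {C : ℝ} (hf : ∀ x, |f x| ≤ C)
    (hfg : ∀ x, f x - ∫ y, f y ∂Q.jumpKernel x = g x / Q.holdingRate x)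
    (hg : Integrable g (Q.occupationKernel t η)) :
    |∫ x, g x ∂Q.occupationKernel t η| ≤ 2 * C := by
  let A : ℕ → Set ((ℕ → E) × (ℕ → ℝ)) := fun n => {ω | Q.jumpTime ω (n + 1) ∈ Set.Icc 0 t}
  have hA (n : ℕ) : MeasurableSet (A n) := Q.measurable_jumpTime (n + 1) measurableSet_Icc
  have hdiff (n : ℕ) : Integrable (fun ω => f (ω.1 n) - f (ω.1 (n + 1))) (Q.pathMeasure η) :=
    (Q.integrable_comp_eval_pathMeasure η hf n).sub
      (Q.integrable_comp_eval_pathMeasure η hf (n + 1))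
  have hterm (n : ℕ) : ∫ ω in A n, g (ω.1 n) / Q.holdingRate (ω.1 n) ∂Q.pathMeasure η =
      ∫ ω in A n, (f (ω.1 n) - f (ω.1 (n + 1))) ∂Q.pathMeasure η := by
    have hint {h : E → ℝ} (hh : ∀ x, |h x| ≤ C) (m : ℕ) :
        IntegrableOn (fun ω => h (ω.1 m)) (A n) (Q.pathMeasure η) :=
      (Q.integrable_comp_eval_pathMeasure η hh m).integrableOn
    simp only [← hfg]
    rw [integral_sub (hint hf n) (hint (Q.abs_integral_jumpKernel_le hf) n),
      integral_sub (hint hf n) (hint hf (n + 1)),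
      Q.setIntegral_jumpTime_mem_succ η n hf measurableSet_Icc]
  have hbound (N : ℕ) : |∑ n ∈ Finset.range N, ∫ ω in A n, g (ω.1 n) / Q.holdingRate (ω.1 n)
      ∂Q.pathMeasure η| ≤ 2 * C := by
    simp only [hterm, ← integral_indicator (hA _)]
    rw [← integral_finsetSum _ fun n _ => (hdiff n).indicator (hA n)]
    simpa only [Real.norm_eq_abs, probReal_univ, mul_one] using
      norm_integral_le_of_norm_le_const (Q.ae_norm_sum_indicator_jumpTime_mem_le η hf t N)
  exact le_of_tendsto (hrec.hasSum_integral_occupationKernel hg).tendsto_sum_nat.abs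
    (.of_forall hbound)

end Dynkin

section Invariance

variable {E : Type*} [MeasurableSpace E] [DiscreteMeasurableSpace E]
  {Q : TransitionRates E}

instance (t : ℝ) : IsFiniteKernel (Q.occupationKernel t) :=
  ⟨ENNReal.ofReal t, ENNReal.ofReal_lt_top, fun η => by
    rw [occupationKernel_apply, Measure.map_apply Q.measurable_process .univ, Set.preimage_univ,
      ← Set.univ_prod_univ, Measure.prod_prod]
    simp⟩

theorem occupationKernel_singleton (Q : TransitionRates E) (t : ℝ) (η ξ : E) :
    Q.occupationKernel t η {ξ} =
      ∫⁻ s in Set.Icc 0 t, Q.pathMeasure η {ω | Q.process s ω = ξ} := by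
  rw [occupationKernel_apply, Measure.map_apply Q.measurable_process .of_discrete,
    Measure.prod_apply_symm (Q.measurable_process .of_discrete)]
  rfl

variable [Countable E] {μ : Measure E}

theorem IsInvariant.occupationKernel_comp (hμ : Q.IsInvariant μ) (t : ℝ) :
    Q.occupationKernel t ∘ₘ μ = ENNReal.ofReal t • μ := by
  refine Measure.ext_of_singleton fun ξ => ?_
  have hmeas (η : E) : Measurable fun s => Q.pathMeasure η {ω | Q.process s ω = ξ} :=
    measurable_measure_prodMk_right (Q.measurable_process (MeasurableSet.singleton ξ))
  calc (Q.occupationKernel t ∘ₘ μ) {ξ}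
      = ∑' η, ∫⁻ s in Set.Icc 0 t, μ {η} * Q.pathMeasure η {ω | Q.process s ω = ξ} := by
        rw [Measure.bind_apply .of_discrete (Kernel.aemeasurable _), lintegral_countable']
        exact tsum_congr fun η => by
          rw [occupationKernel_singleton, mul_comm, lintegral_const_mul _ (hmeas η)]
    _ = ∫⁻ _ in Set.Icc 0 t, μ {ξ} := by
        rw [← lintegral_tsum fun η => ((hmeas η).const_mul _).aemeasurable]
        exact setLIntegral_congr_fun measurableSet_Icc fun _ hs => hμ _ hs.1 ξ
    _ = (ENNReal.ofReal t • μ) {ξ} := by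
        simp [mul_comm]

theorem IsRecurrent.exists_occupationKernel_singleton_ne_zero (hrec : Q.IsRecurrent)
    (hirr : Q.IsIrreducible) (η ξ : E) : ∃ t, Q.occupationKernel t η {ξ} ≠ 0 := by
  by_contra! hzero
  obtain ⟨n, hn⟩ := hirr η ξ
  have hne (t : ℕ) : ∀ᵐ ω ∂Q.pathMeasure η,
      Q.jumpTime ω (n + 1) ∈ Set.Icc 0 (t : ℝ) → ω.1 n ≠ ξ := by
    have h := hzero t
    rw [hrec.occupationKernel_eq_sum, Measure.sum_apply _ .of_discrete,
      ENNReal.tsum_eq_zero] at h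
    have hrate : ∀ᵐ x ∂((Q.pathMeasure η).restrict
        {ω | Q.jumpTime ω (n + 1) ∈ Set.Icc 0 (t : ℝ)}).map fun ω => ω.1 n,
        ENNReal.ofReal (1 / Q.holdingRate x) ≠ 0 := .of_forall fun x =>
      (ENNReal.ofReal_pos.2 (one_div_pos.2 (Q.holdingRate_pos x))).ne'
    have hmap := compl_mem_ae_iff.2 <|
      withDensity_absolutelyContinuous' Measurable.of_discrete.aemeasurable hrate (h n)
    exact (ae_restrict_iff' (Q.measurable_jumpTime (n + 1) measurableSet_Icc)).1
      (ae_of_ae_map (f := fun ω : (ℕ → E) × (ℕ → ℝ) => ω.1 n) (p := (· ≠ ξ))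
        (Measurable.aemeasurable (by fun_prop)) hmap)
  have hnull : ∀ᵐ ω ∂Q.pathMeasure η, ω.1 n ≠ ξ := by
    filter_upwards [Q.ae_monotone_jumpTime η, ae_all_iff.2 hne] with ω hω hne
    obtain ⟨t, ht⟩ := exists_nat_ge (Q.jumpTime ω (n + 1))
    exact hne t ⟨(by simp [jumpTime] : 0 ≤ Q.jumpTime ω 0).trans (hω (Nat.zero_le _)), ht⟩
  have hfst : Q.pathMeasure η {ω | ω.1 n = ξ} = Q.jumpChainLaw η {y | y n = ξ} :=
    measurePreserving_fst.measure_preimage (s := {y : ℕ → E | y n = ξ})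
      (measurableSet_eq_fun (by fun_prop) measurable_const).nullMeasurableSet
  exact hn.ne' (by simpa [ae_iff, hfst] using hnull)

theorem IsInvariant.measure_singleton_ne_zero [NeZero μ] (hμ : Q.IsInvariant μ)
    (hrec : Q.IsRecurrent) (hirr : Q.IsIrreducible) (ξ : E) : μ {ξ} ≠ 0 := by
  intro hξ
  obtain ⟨η, hη⟩ : ∃ η, μ {η} ≠ 0 := by
    by_contra! h
    exact NeZero.ne μ (Measure.ext_of_singleton h)
  obtain ⟨t, ht⟩ := hrec.exists_occupationKernel_singleton_ne_zero hirr η ξ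
  have hocc := congrArg (· {ξ}) (hμ.occupationKernel_comp t)
  simp only [Measure.bind_apply (MeasurableSet.singleton ξ) (Kernel.aemeasurable _),
    lintegral_countable', Measure.smul_apply, hξ, smul_zero, ENNReal.tsum_eq_zero] at hocc
  exact mul_ne_zero ht hη (hocc η)

theorem IsInvariant.integrable_occupationKernel_comp (hμ : Q.IsInvariant μ) {g : E → ℝ}
    (hg : Integrable g μ) (t : ℝ) : Integrable g (Q.occupationKernel t ∘ₘ μ) := by
  rw [hμ.occupationKernel_comp]
  exact hg.smul_measure ENNReal.ofReal_ne_top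

theorem IsInvariant.integrable_occupationKernel [NeZero μ] (hμ : Q.IsInvariant μ)
    (hrec : Q.IsRecurrent) (hirr : Q.IsIrreducible) {g : E → ℝ} (hg : Integrable g μ) (t : ℝ)
    (η : E) : Integrable g (Q.occupationKernel t η) := by
  have hcomp := hμ.integrable_occupationKernel_comp hg t
  exact ae_iff_of_countable.1 ((Measure.integrable_comp_iff hcomp.1).1 hcomp).1 η
    (hμ.measure_singleton_ne_zero hrec hirr η)

theorem IsInvariant.integral_integral_occupationKernel (hμ : Q.IsInvariant μ) {g : E → ℝ}
    (hg : Integrable g μ) {t : ℝ} (ht : 0 ≤ t) :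
    ∫ η, (∫ x, g x ∂Q.occupationKernel t η) ∂μ = t * ∫ x, g x ∂μ := by
  have hcomp := hμ.integrable_occupationKernel_comp hg t
  rw [Measure.comp_eq_comp_const_apply] at hcomp
  have hfubini := Kernel.integral_comp hcomp
  rw [← Measure.comp_eq_comp_const_apply, hμ.occupationKernel_comp, integral_smul_measure,
    ENNReal.toReal_ofReal ht, smul_eq_mul, Kernel.const_apply] at hfubini
  exact hfubini.symm

end Invariance

section PoissonBound

variable {E : Type*} [Countable E] [MeasurableSpace E] [DiscreteMeasurableSpace E]
  {Q : TransitionRates E} {μ : Measure E} [IsFiniteMeasure μ] [NeZero μ]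

theorem IsInvariant.integral_eq_zero_of_poisson (hμ : Q.IsInvariant μ) (hrec : Q.IsRecurrent)
    (hirr : Q.IsIrreducible) {f g : E → ℝ} {C : ℝ} (hf : ∀ x, |f x| ≤ C) (hg : Integrable g μ)
    (hfg : ∀ x, f x - ∫ y, f y ∂Q.jumpKernel x = g x / Q.holdingRate x) :
    ∫ x, g x ∂μ = 0 := by
  have hgrowth (n : ℕ) : n * |∫ x, g x ∂μ| ≤ 2 * C * μ.real Set.univ := by
    have hbound := norm_integral_le_of_norm_le_const (μ := μ)
      (f := fun η => ∫ x, g x ∂Q.occupationKernel n η) (.of_forall fun η =>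
        abs_integral_occupationKernel_le hrec hf hfg
          (hμ.integrable_occupationKernel hrec hirr hg n η))
    rwa [hμ.integral_integral_occupationKernel hg n.cast_nonneg, Real.norm_eq_abs, abs_mul,
      Nat.abs_cast] at hbound
  by_contra hne
  obtain ⟨n, hn⟩ := exists_nat_gt (2 * C * μ.real Set.univ / |∫ x, g x ∂μ|)
  exact (hgrowth n).not_gt ((div_lt_iff₀ (abs_pos.2 hne)).1 hn)

theorem IsInvariant.poisson_eq_of_forall_ne (hμ : Q.IsInvariant μ) (hrec : Q.IsRecurrent)
    (hirr : Q.IsIrreducible) {f g : E → ℝ} {C : ℝ} (hf : ∀ x, |f x| ≤ C) (hg : Integrable g μ)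
    (hg0 : ∫ x, g x ∂μ = 0) {ξ : E}
    (hfg : ∀ x, x ≠ ξ → f x - ∫ y, f y ∂Q.jumpKernel x = g x / Q.holdingRate x) (x : E) :
    f x - ∫ y, f y ∂Q.jumpKernel x = g x / Q.holdingRate x := by
  let d : ℝ := (f ξ - ∫ y, f y ∂Q.jumpKernel ξ) * Q.holdingRate ξ - g ξ
  have hd_int : Integrable (({ξ} : Set E).indicator fun _ => d) μ :=
    (integrable_const d).indicator (MeasurableSet.singleton ξ)
  have hcorrected (x : E) : f x - ∫ y, f y ∂Q.jumpKernel x =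
      (g x + ({ξ} : Set E).indicator (fun _ => d) x) / Q.holdingRate x := by
    by_cases hx : x = ξ
    · subst hx
      simp [d, (Q.holdingRate_pos x).ne']
    · simpa [hx] using hfg x hx
  have hd : d = 0 := by
    have h := hμ.integral_eq_zero_of_poisson hrec hirr hf (hg.add hd_int) hcorrected
    rw [integral_add' hg hd_int, hg0, zero_add,
      integral_indicator_const d (MeasurableSet.singleton ξ), smul_eq_mul] at h
    exact (mul_eq_zero.1 h).resolve_left
      ((measureReal_ne_zero_iff (measure_ne_top _ _)).2 (hμ.measure_singleton_ne_zero hrec hirr ξ))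
  simpa [hd] using hcorrected x

theorem IsInvariant.iSup_abs_expTimeIntegral_le (hμ : Q.IsInvariant μ) (hrec : Q.IsRecurrent)
    (hirr : Q.IsIrreducible) {g : E → ℝ} (hg : Integrable g μ) (hg0 : ∫ x, g x ∂μ = 0) (ξ : E)
    {A : Set E} (hA : ∀ x ∉ A, g x = 0) {t : ℝ} (ht : 0 ≤ t) :
    ⨆ η, ENNReal.ofReal |Q.expTimeIntegral g t η| ≤
      2 * ⨆ η ∈ A, Q.expAbsIntegralUntilHit g ξ η := by
  set C := ⨆ η ∈ A, Q.expAbsIntegralUntilHit g ξ η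
  by_cases hC : C = ∞
  · simp [hC]
  have hpotential (x : E) : killedPotential Q.jumpKernel (({ξ} : Set E)ᶜ.indicator 1)
      (fun y => ENNReal.ofReal |g y / Q.holdingRate y|) x ≤ C :=
    killedPotential_le_of_le_on (Set.indicator_le_self' fun _ _ => zero_le_one)
      (fun y hy => by simp [hA y hy])
      (fun y hy => (hrec.killedPotential_le_expAbsIntegralUntilHit g ξ y).trans
        (le_iSup₂ (f := fun η (_ : η ∈ A) => Q.expAbsIntegralUntilHit g ξ η) y hy)) x
  obtain ⟨f, hf, hfg⟩ := exists_bounded_poisson_solution hC hpotential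
  have hpoisson := hμ.poisson_eq_of_forall_ne hrec hirr hf hg hg0 (ξ := ξ)
    fun x hx => hfg x (by simp [hx])
  refine iSup_le fun η => ?_
  have hint := hμ.integrable_occupationKernel hrec hirr hg t η
  rw [Q.expTimeIntegral_eq_integral_occupationKernel ht hint]
  calc ENNReal.ofReal |∫ x, g x ∂Q.occupationKernel t η|
      ≤ ENNReal.ofReal (2 * C.toReal) :=
        ENNReal.ofReal_le_ofReal (abs_integral_occupationKernel_le hrec hf hpoisson hint)
    _ = 2 * C := by
        rw [ENNReal.ofReal_mul two_pos.le, ENNReal.ofReal_toReal hC, ENNReal.ofReal_ofNat]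

end PoissonBound

theorem iSup_abs_expTimeIntegral_sum_le {E S : Type*} [Countable E] [MeasurableSpace E]
    [DiscreteMeasurableSpace E] [Fintype S] (Q : TransitionRates E) {g : S → E → ℝ} {t : ℝ}
    (ht : 0 ≤ t) (hg : ∀ i η, Q.TimeIntegrable (g i) t η) :
    ⨆ η, ENNReal.ofReal |Q.expTimeIntegral (fun x => ∑ i, g i x) t η| ≤
      ∑ i, ⨆ η, ENNReal.ofReal |Q.expTimeIntegral (g i) t η| := by
  refine iSup_le fun η => ?_
  have hint (i : S) := Q.integrable_occupationKernel_iff.2 (hg i η)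
  have hsum : Q.expTimeIntegral (fun x => ∑ i, g i x) t η = ∑ i, Q.expTimeIntegral (g i) t η := by
    rw [Q.expTimeIntegral_eq_integral_occupationKernel ht
      (integrable_finsetSum _ fun i _ => hint i), integral_finsetSum _ fun i _ => hint i]
    exact Finset.sum_congr rfl fun i _ =>
      (Q.expTimeIntegral_eq_integral_occupationKernel ht (hint i)).symm
  calc ENNReal.ofReal |Q.expTimeIntegral (fun x => ∑ i, g i x) t η|
      ≤ ENNReal.ofReal (∑ i, |Q.expTimeIntegral (g i) t η|) :=
        ENNReal.ofReal_le_ofReal (hsum ▸ Finset.abs_sum_le_sum_abs _ _)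
    _ = ∑ i, ENNReal.ofReal |Q.expTimeIntegral (g i) t η| :=
        ENNReal.ofReal_sum_of_nonneg fun i _ => abs_nonneg _
    _ ≤ ∑ i, ⨆ η, ENNReal.ofReal |Q.expTimeIntegral (g i) t η| :=
        Finset.sum_le_sum fun i _ =>
          le_iSup (fun η => ENNReal.ofReal |Q.expTimeIntegral (g i) t η|) η

end TransitionRates

section Partition

variable {E : Type*} [MeasurableSpace E] {μ : Measure E} {g : E → ℝ}

theorem sub_partitionCondExp_eq_sum {S : Type*} [Fintype S] {A : S → Set E}
    (hdisj : Pairwise fun x y => Disjoint (A x) (A y)) (hcover : ⋃ x, A x = Set.univ) :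
    (fun ζ => g ζ - partitionCondExp μ A g ζ) = fun ζ => ∑ x, centeredOn μ (A x) g ζ := by
  ext ζ
  obtain ⟨x, hx⟩ := Set.mem_iUnion.1 (hcover ▸ Set.mem_univ ζ)
  have hnot (y : S) (hy : y ≠ x) : ζ ∉ A y := fun h => Set.disjoint_left.1 (hdisj hy) h hx
  have hsum (f : S → E → ℝ) : ∑ y, (A y).indicator (f y) ζ = f x ζ := by
    rw [Finset.sum_eq_single x (fun y _ hy => Set.indicator_of_notMem (hnot y hy) _) (by simp),
      Set.indicator_of_mem hx]
  simp only [partitionCondExp, centeredOn, hsum]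

variable [DiscreteMeasurableSpace E] [IsFiniteMeasure μ]

theorem integral_centeredOn (B : Set E) (g : E → ℝ) :
    ∫ x, centeredOn μ B g x ∂μ = 0 := by
  by_cases hB : μ B = 0
  · rw [centeredOn, integral_indicator .of_discrete, Measure.restrict_eq_zero.2 hB,
      integral_zero_measure]
  · have haverage : ∫ x, g x ∂(ProbabilityTheory.cond μ B) = ⨍ x in B, g x ∂μ := by
      rw [average, ProbabilityTheory.cond, Measure.restrict_apply_univ]
    rw [centeredOn, integral_indicator .of_discrete, haverage, integral_sub_average]

theorem integrable_centeredOn (hg : Integrable g μ) (B : Set E) :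
    Integrable (centeredOn μ B g) μ :=
  (hg.sub (integrable_const _)).indicator .of_discrete

end Partition

end

theorem lemma6p4_general {E : Type*} [Countable E] [MeasurableSpace E] [DiscreteMeasurableSpace E]
    (Q : TransitionRates E) (hirr : Q.IsIrreducible) (hrec : Q.IsRecurrent)
    (μ : Measure E) [IsFiniteMeasure μ] [NeZero μ] (hμ : Q.IsInvariant μ) :
    (∀ (g : E → ℝ) (ξ : E), Integrable g μ → ∫ η, g η ∂μ = 0 →
      ∀ t : ℝ, 0 ≤ t →
        (∀ η, Q.TimeIntegrable g t η) ∧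
        (⨆ η, ENNReal.ofReal |Q.expTimeIntegral g t η|) ≤
          2 * ⨆ η ∈ {η | g η ≠ 0}, Q.expAbsIntegralUntilHit g ξ η) ∧
    (∀ (S : Type*) [Fintype S] (A : S → Set E) (ξ : S → E),
      Pairwise (fun x y => Disjoint (A x) (A y)) → (⋃ x, A x) = Set.univ →
      ∀ g : E → ℝ, Integrable g μ → ∀ t : ℝ, 0 ≤ t →
        (∀ η, Q.TimeIntegrable (fun ζ => g ζ - partitionCondExp μ A g ζ) t η) ∧
        (⨆ η, ENNReal.ofReal
            |Q.expTimeIntegral (fun ζ => g ζ - partitionCondExp μ A g ζ) t η|) ≤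
          2 * ∑ x, ⨆ η ∈ A x, Q.expAbsIntegralUntilHit (centeredOn μ (A x) g) (ξ x) η) := by
  have timeIntegrable {f : E → ℝ} (hf : Integrable f μ) (t : ℝ) (η : E) : Q.TimeIntegrable f t η :=
    Q.integrable_occupationKernel_iff.1 (hμ.integrable_occupationKernel hrec hirr hf t η)
  refine ⟨fun g ξ hg hg0 t ht => ⟨timeIntegrable hg t,
    hμ.iSup_abs_expTimeIntegral_le hrec hirr hg hg0 ξ (fun _ => not_not.1) ht⟩,
    fun S _ A ξ hdisj hcover g hg t ht => ?_⟩
  rw [sub_partitionCondExp_eq_sum hdisj hcover, Finset.mul_sum]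
  have hint (x : S) := integrable_centeredOn hg (A x)
  refine ⟨timeIntegrable (integrable_finsetSum _ fun x _ => hint x) t, ?_⟩
  calc ⨆ η, ENNReal.ofReal |Q.expTimeIntegral (fun ζ => ∑ x, centeredOn μ (A x) g ζ) t η|
      ≤ ∑ x, ⨆ η, ENNReal.ofReal |Q.expTimeIntegral (centeredOn μ (A x) g) t η| :=
        Q.iSup_abs_expTimeIntegral_sum_le ht fun x => timeIntegrable (hint x) t
    _ ≤ ∑ x, 2 * ⨆ η ∈ A x, Q.expAbsIntegralUntilHit (centeredOn μ (A x) g) (ξ x) η :=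
        Finset.sum_le_sum fun x _ => hμ.iSup_abs_expTimeIntegral_le hrec hirr (hint x)
          (integral_centeredOn (A x) g) (ξ x) (fun _ h => Set.indicator_of_notMem h _) ht

theorem lemma6p4 {E : Type*} [Countable E] [MeasurableSpace E] [DiscreteMeasurableSpace E]
    (Q : TransitionRates E) (hirr : Q.IsIrreducible) (hrec : Q.IsRecurrent)
    (hpos : Q.HasFiniteMeanReturnTimes)
    (μ : Measure E) [IsProbabilityMeasure μ] (hμ : Q.IsInvariant μ) :
    (∀ (g : E → ℝ) (ξ : E), Integrable g μ → ∫ η, g η ∂μ = 0 → g ξ ≠ 0 →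
      ∀ t : ℝ, 0 < t →
        (∀ η, Q.TimeIntegrable g t η) ∧
        (⨆ η, ENNReal.ofReal |Q.expTimeIntegral g t η|) ≤
          2 * ⨆ η ∈ {η | g η ≠ 0}, Q.expAbsIntegralUntilHit g ξ η) ∧
    (∀ (S : Type*) [Fintype S] (A : S → Set E) (ξ : S → E),
      Pairwise (fun x y => Disjoint (A x) (A y)) → (⋃ x, A x) = Set.univ → (∀ x, ξ x ∈ A x) →
      ∀ g : E → ℝ, Integrable g μ → ∀ t : ℝ, 0 < t →
        (∀ η, Q.TimeIntegrable (fun ζ => g ζ - partitionCondExp μ A g ζ) t η) ∧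
        (⨆ η, ENNReal.ofReal
            |Q.expTimeIntegral (fun ζ => g ζ - partitionCondExp μ A g ζ) t η|) ≤
          2 * ∑ x, ⨆ η ∈ A x, Q.expAbsIntegralUntilHit (centeredOn μ (A x) g) (ξ x) η) := by
  have hgen := lemma6p4_general Q hirr hrec μ hμ
  exact ⟨fun g ξ hg hg0 _ t ht => hgen.1 g ξ hg hg0 t ht.le,
    fun S _ A ξ hdisj hcover _ g hg t ht => hgen.2 S A ξ hdisj hcover g hg t ht.le⟩
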